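/- Let $K$ be a commutative ring. Let $\widehat\Lambda$ be the $K$-algebra of all symmetric formal power series over $K$ in the variables $x=(x_1,x_2,\dots)$ (of possibly unbounded degree), and let $\Lambda\subset\widehat\Lambda$ be the ring of symmetric functions, i.e. the symmetric power series of bounded degree. Let $(\,,)\colon\widehat\Lambda\times\Lambda\to K$ be the Hall inner product, $\bigl(\sum_\lambda A_\lambda s_\lambda,\sum_\lambda B_\lambda s_\lambda\bigr)=\sum_\lambda A_\lambda B_\lambda$, where $s_\lambda$ are the Schur functions. Let $\Delta\colon\Lambda\to\Lambda\otimes_K\Lambda$ be the coproduct $f(x)\mapsto f(x,y)\in\Lambda(x)\otimes\Lambda(y)$, where $f(x,y)=f(x_1,x_2,\dots,y_1,y_2,\dots)$. For $F\in\widehat\Lambda$ let $(F,-)\colon\Lambda\to K$ be the linear map $f\mapsto(F,f)$, and let $F^\perp=((F,-)\otimes\mathrm{id})\circ\Delta\colon\Lambda\to\Lambda$, i.e. $F^\perp(f)=\sum(F,f_1)f_2$ where $\Delta(f)=\sum f_1\otimes f_2$. Then for every $F\in\widehat\Lambda$ the following are equivalent: 1. $F$ is group-like, that is, $F(x,y)=F(x)F(y)$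 and the constant term $F(0)$ is $1$. 2. $(F,-)\colon\Lambda\to K$ is a homomorphism of (unital) $K$-algebras. 3. $F^\perp\colon\Lambda\to\Lambda$ is an automorphism of the $K$-algebra $\Lambda$. -/

import Mathlib

open scoped TensorProduct

noncomputable section

namespace SymmFn

/-! ### Symmetric power series and symmetric functions -/

/-- The completed ring of symmetric functions: all formal power series in countably many variables
`x_0, x_1, …` over `K` (of possibly unbounded degree) which are invariant under every permutation
of the variables. -/
def SymSeries (K : Type*) [CommRing K] : Subalgebra K (MvPowerSeries ℕ K) where
  carrier := {F | ∀ σ : Equiv.Perm ℕ, MvPowerSeries.rename σ F = F}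
  mul_mem' ha hb σ := by rw [map_mul, ha σ, hb σ]
  add_mem' ha hb σ := by rw [map_add, ha σ, hb σ]
  algebraMap_mem' r σ := AlgHom.commutes _ r

/-- The ring of symmetric functions: the symmetric power series of bounded degree. -/
def SymFun (K : Type*) [CommRing K] : Subalgebra K (MvPowerSeries ℕ K) where
  carrier := {f | f ∈ SymSeries K ∧ ∃ N : ℕ, ∀ d : ℕ →₀ ℕ, N < d.degree → f.coeff d = 0}
  mul_mem' := by
    rintro a b ⟨ha, N, hN⟩ ⟨hb, M, hM⟩
    refine ⟨mul_mem ha hb, N + M, fun d hd => ?_⟩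
    classical
    rw [MvPowerSeries.coeff_mul]
    refine Finset.sum_eq_zero fun p hp => ?_
    rw [Finset.HasAntidiagonal.mem_antidiagonal] at hp
    have h : N < p.1.degree ∨ M < p.2.degree := by
      rw [← hp, map_add] at hd
      omega
    rcases h with h | h
    · rw [hN _ h, zero_mul]
    · rw [hM _ h, mul_zero]
  add_mem' := by
    rintro a b ⟨ha, N, hN⟩ ⟨hb, M, hM⟩
    refine ⟨add_mem ha hb, max N M, fun d hd => ?_⟩
    rw [map_add, hN _ ((le_max_left _ _).trans_lt hd), hM _ ((le_max_right _ _).trans_lt hd),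
      add_zero]
  algebraMap_mem' r := by
    refine ⟨Subalgebra.algebraMap_mem _ r, 0, fun d hd => ?_⟩
    classical
    rw [MvPowerSeries.algebraMap_apply, MvPowerSeries.coeff_C, if_neg]
    rintro rfl
    simp at hd

/-! ### Schur functions and the Hall inner product -/

/-- The content of a semistandard tableau `T`: the exponent vector of
the monomial `x^T`, the product of the `x_{T(c)}` over all cells `c`. -/
def content {lam : YoungDiagram} (T : SemistandardYoungTableau lam) : ℕ →₀ ℕ :=
  ∑ c ∈ lam.cells, Finsupp.single (T c.1 c.2) 1

/-- The Schur function `s_lam`, the sum of `x^T` over all semistandard tableaux of shape `lam`. -/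
def schur (K : Type*) [CommRing K] (lam : YoungDiagram) : MvPowerSeries ℕ K :=
  fun d => (Nat.card {T : SemistandardYoungTableau lam // content T = d} : K)

/-- The partitions of `n`, as Young diagrams with `n` cells. -/
abbrev Part (n : ℕ) : Type := {lam : YoungDiagram // lam.card = n}

theorem subset_range_of_card {n : ℕ} (lam : Part n) :
    lam.1.cells ⊆ Finset.range n ×ˢ Finset.range n := by
  obtain ⟨lam, rfl⟩ := lam
  rintro ⟨i, j⟩ h
  have hi : (Finset.range (i + 1) ×ˢ Finset.range (j + 1)) ⊆ lam.cells := by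
    rintro ⟨a, b⟩ hab
    simp only [Finset.mem_product, Finset.mem_range] at hab
    exact lam.up_left_mem (by omega) (by omega) h
  have hc := Finset.card_le_card hi
  rw [Finset.card_product, Finset.card_range, Finset.card_range] at hc
  simp only [Finset.mem_product, Finset.mem_range, YoungDiagram.card]
  constructor <;> nlinarith

instance (n : ℕ) : Finite (Part n) :=
  Finite.of_injective
    (fun lam : Part n => (⟨lam.1.cells, Finset.mem_powerset.2 (subset_range_of_card lam)⟩ :
      {s // s ∈ (Finset.range n ×ˢ Finset.range n).powerset}))
    fun _ _ h => Subtype.ext (YoungDiagram.ext (congrArg Subtype.val h))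

instance (n : ℕ) : Fintype (Part n) := Fintype.ofFinite _

instance (n : ℕ) : DecidableEq (Part n) := Classical.decEq _

/-- The exponent vector of the monomial `x^lam = x_0^{lam_0} x_1^{lam_1} ⋯`. -/
def expo (lam : YoungDiagram) : ℕ →₀ ℕ :=
  Finsupp.onFinset (Finset.range (lam.colLen 0)) lam.rowLen fun i hi => by
    rw [Finset.mem_range, ← YoungDiagram.mem_iff_lt_colLen, YoungDiagram.mem_iff_lt_rowLen]
    omega

/-- The matrix of the coefficients of `x^mu` in `s_lam`, for partitions `lam`, `mu` of `n`. -/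
def kostka (K : Type*) [CommRing K] (n : ℕ) : Matrix (Part n) (Part n) K :=
  Matrix.of fun lam mu => (schur K lam.1).coeff (expo mu.1)

/-- The coefficients `A_lam`, `lam` a partition of `n`, in the Schur expansion
`F = ∑ A_lam s_lam` of a symmetric power series `F`. As `F` is determined by its
coefficients at the monomials `x^mu`, they are the solution of the linear system
`[x^mu] F = ∑_lam A_lam [x^mu] s_lam`, whose matrix is invertible
(see `kostka_det` below; `schurCoeff_spec` and `schurCoeff_unique` for the solution). -/
def schurCoeff (K : Type*) [CommRing K] (n : ℕ) : MvPowerSeries ℕ K →ₗ[K] (Part n → K) where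
  toFun F := Matrix.vecMul (fun mu : Part n => F.coeff (expo mu.1)) (kostka K n)⁻¹
  map_add' F G := by
    rw [← Matrix.add_vecMul]
    congr 1
  map_smul' r F := by
    rw [RingHom.id_apply, ← Matrix.smul_vecMul]
    congr 1

theorem degree_expo (lam : YoungDiagram) : (expo lam).degree = lam.card := by
  have hs : (expo lam).support ⊆ Finset.range (lam.colLen 0) := Finsupp.support_onFinset_subset
  rw [Finsupp.degree_apply, Finset.sum_subset hs (fun i _ hi => by simpa using hi),
    YoungDiagram.card]
  rw [Finset.card_eq_sum_card_fiberwise (f := Prod.fst) (t := Finset.range (lam.colLen 0))]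
  · exact Finset.sum_congr rfl fun i _ => lam.rowLen_eq_card
  · rintro ⟨i, j⟩ h
    rw [Finset.coe_range, Set.mem_Iio, ← YoungDiagram.mem_iff_lt_colLen]
    exact lam.up_left_mem le_rfl (Nat.zero_le _) h

theorem finite_support_schurCoeff {K : Type*} [CommRing K] (F : MvPowerSeries ℕ K) (f : SymFun K) :
    (Function.support fun n => ∑ lam : Part n, schurCoeff K n F lam * schurCoeff K n f lam).Finite := by
  obtain ⟨N, hN⟩ := f.2.2
  refine (Set.finite_Iic N).subset fun n hn => ?_
  by_contra h
  refine hn (Finset.sum_eq_zero fun lam _ => ?_)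
  have h0 : (fun mu : Part n => MvPowerSeries.coeff (expo mu.1) (f : MvPowerSeries ℕ K)) = 0 := by
    funext mu
    refine hN _ ?_
    rw [degree_expo, mu.2]
    simpa using h
  have h1 : schurCoeff K n (f : MvPowerSeries ℕ K) = 0 := by
    change Matrix.vecMul _ _ = 0
    rw [h0, Matrix.zero_vecMul]
  rw [h1]
  simp

/-- The Hall inner product, extended to a pairing of symmetric power series with symmetric
functions: `(∑ A_lam s_lam, ∑ B_lam s_lam) = ∑ A_lam B_lam`, so that `(s_lam, s_mu) = δ`.
Only finitely many terms are nonzero since the second argument has bounded degree. -/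
def hall {K : Type*} [CommRing K] : SymSeries K →ₗ[K] SymFun K →ₗ[K] K :=
  LinearMap.mk₂ K
    (fun F f => ∑ᶠ n : ℕ, ∑ lam : Part n, schurCoeff K n F lam * schurCoeff K n f lam)
    (fun F G f => by
      rw [← finsum_add_distrib (finite_support_schurCoeff _ _) (finite_support_schurCoeff _ _)]
      simp [add_mul, Finset.sum_add_distrib])
    (fun r F f => by
      rw [smul_finsum' _ (finite_support_schurCoeff _ _)]
      simp [Finset.mul_sum, mul_assoc])
    (fun F f g => by
      rw [← finsum_add_distrib (finite_support_schurCoeff _ _) (finite_support_schurCoeff _ _)]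
      simp [mul_add, Finset.sum_add_distrib])
    (fun r F f => by
      rw [smul_finsum' _ (finite_support_schurCoeff _ _)]
      simp [Finset.mul_sum, mul_left_comm])

theorem le_entry {lam : YoungDiagram} (T : SemistandardYoungTableau lam) {i j : ℕ}
    (h : (i, j) ∈ lam) : i ≤ T i j := by
  induction i with
  | zero => exact Nat.zero_le _
  | succ i ih =>
    have h' : (i, j) ∈ lam := lam.up_left_mem (Nat.le_succ i) le_rfl h
    have : T i j < T (i + 1) j := T.col_strict (Nat.lt_succ_self i) h
    have := ih h'
    omega

/-- Weighted counting of entries. -/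
theorem content_sum {lam : YoungDiagram} (T : SemistandardYoungTableau lam) (w : ℕ → ℕ) :
    ((content T).sum fun i k => k * w i) = ∑ c ∈ lam.cells, w (T c.1 c.2) := by
  rw [content, ← Finsupp.sum_finsetSum_index (by simp) (by intros; ring)]
  exact Finset.sum_congr rfl fun c _ => by simp

theorem content_highestWeight (lam : YoungDiagram) :
    content (SemistandardYoungTableau.highestWeight lam) = expo lam := by
  ext i
  rw [content, Finsupp.finsetSum_apply]
  change _ = lam.rowLen i
  rw [YoungDiagram.rowLen_eq_card, YoungDiagram.row, Finset.card_filter]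
  refine Finset.sum_congr rfl fun c hc => ?_
  have hc' : (c.1, c.2) ∈ lam := hc
  rw [SemistandardYoungTableau.highestWeight_apply, if_pos hc', Finsupp.single_apply]

theorem eq_highestWeight {lam : YoungDiagram} (T : SemistandardYoungTableau lam)
    (hT : content T = expo lam) : T = SemistandardYoungTableau.highestWeight lam := by
  have h1 := content_sum T id
  have h2 := content_sum (SemistandardYoungTableau.highestWeight lam) id
  rw [content_highestWeight, ← hT, h1] at h2
  have h3 : ∀ c ∈ lam.cells, SemistandardYoungTableau.highestWeight lam c.1 c.2 = c.1 := by
    intro c hc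
    have hc' : (c.1, c.2) ∈ lam := hc
    rw [SemistandardYoungTableau.highestWeight_apply, if_pos hc']
  have h4 : ∀ c ∈ lam.cells, c.1 = T c.1 c.2 := by
    refine (Finset.sum_eq_sum_iff_of_le fun c hc => le_entry T hc).1 ?_
    rw [← Finset.sum_congr rfl h3]
    exact h2.symm
  ext i j
  rw [SemistandardYoungTableau.highestWeight_apply]
  split_ifs with h
  · exact (h4 (i, j) h).symm
  · exact T.zeros h

theorem kostka_diag (K : Type*) [CommRing K] {n : ℕ} (lam : Part n) : kostka K n lam lam = 1 := by
  have : Nat.card {T : SemistandardYoungTableau lam.1 // content T = expo lam.1} = 1 := by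
    rw [Nat.card_eq_one_iff_unique]
    exact ⟨⟨fun a b => Subtype.ext ((eq_highestWeight _ a.2).trans (eq_highestWeight _ b.2).symm)⟩,
      ⟨⟨_, content_highestWeight _⟩⟩⟩
  change ((Nat.card _ : ℕ) : K) = 1
  rw [this, Nat.cast_one]

theorem expo_injective : Function.Injective expo := by
  intro a b h
  ext ⟨i, j⟩
  have : a.rowLen i = b.rowLen i := DFunLike.congr_fun h i
  rw [YoungDiagram.mem_cells, YoungDiagram.mem_cells, YoungDiagram.mem_iff_lt_rowLen,
    YoungDiagram.mem_iff_lt_rowLen, this]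

theorem kostka_eq_zero (K : Type*) [CommRing K] {n : ℕ} {lam mu : Part n}
    (h : toLex (expo lam.1) < toLex (expo mu.1)) : kostka K n lam mu = 0 := by
  obtain ⟨i, h1, h2⟩ := Finsupp.Lex.lt_iff.1 h
  have : IsEmpty {T : SemistandardYoungTableau lam.1 // content T = expo mu.1} := by
    refine ⟨fun ⟨T, hT⟩ => ?_⟩
    have e1 := content_sum T fun k => if k ≤ i then 1 else 0
    have e2 := content_sum (SemistandardYoungTableau.highestWeight lam.1)
      fun k => if k ≤ i then 1 else 0
    rw [hT] at e1
    rw [content_highestWeight] at e2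
    have e3 : ∀ g : ℕ →₀ ℕ, (g.sum fun k m => m * if k ≤ i then 1 else 0) =
        ∑ k ∈ Finset.range (i + 1), g k := by
      intro g
      rw [Finsupp.sum_of_support_subset (s := g.support ∪ Finset.range (i + 1)) _
        Finset.subset_union_left _ (by simp)]
      simp only [mul_ite, mul_one, mul_zero]
      rw [← Finset.sum_filter]
      refine Finset.sum_subset_zero_on_sdiff (s₁ := _) (fun k hk => ?_) (fun k hk => ?_)
        (fun _ _ => rfl)
      · simp only [Finset.mem_filter] at hk
        simpa [Nat.lt_succ_iff] using hk.2
      · simp only [Finset.mem_sdiff, Finset.mem_filter, Finset.mem_union, Finset.mem_range] at hk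
        exact absurd ⟨Or.inr hk.1, by omega⟩ hk.2
    rw [e3] at e1 e2
    have e4 : (∑ k ∈ Finset.range (i + 1), expo mu.1 k)
        ≤ ∑ k ∈ Finset.range (i + 1), expo lam.1 k := by
      rw [e1, e2]
      refine Finset.sum_le_sum fun c hc => ?_
      have hc' : (c.1, c.2) ∈ lam.1 := hc
      rw [SemistandardYoungTableau.highestWeight_apply, if_pos hc']
      have := le_entry T hc'
      split_ifs <;> omega
    rw [Finset.sum_range_succ, Finset.sum_range_succ] at e4
    have e5 : ∑ k ∈ Finset.range i, expo lam.1 k = ∑ k ∈ Finset.range i, expo mu.1 k :=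
      Finset.sum_congr rfl fun k hk => h1 k (Finset.mem_range.1 hk)
    have e6 : expo lam.1 i < expo mu.1 i := h2
    omega
  change ((Nat.card _ : ℕ) : K) = 0
  rw [Nat.card_of_isEmpty, Nat.cast_zero]

theorem det_eq_one_of_triangular {m α R : Type*} [Fintype m] [DecidableEq m] [LinearOrder α]
    [CommRing R] (b : m → α) (hb : Function.Injective b) (M : Matrix m m R)
    (h : ∀ i j, b i < b j → M i j = 0) (h1 : ∀ i, M i i = 1) : M.det = 1 := by
  let : LinearOrder m := LinearOrder.lift' b hb
  have := Matrix.det_of_isLowerTriangular M fun i j hij => h i j hij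
  simp only [h1, Finset.prod_const_one] at this
  convert this

theorem kostka_det (K : Type*) [CommRing K] (n : ℕ) : (kostka K n).det = 1 :=
  det_eq_one_of_triangular (fun lam : Part n => toLex (expo lam.1))
    (fun _ _ h => Subtype.ext (expo_injective (toLex.injective h))) _
    (fun _ _ h => kostka_eq_zero K h) (kostka_diag K)

theorem schurCoeff_spec (K : Type*) [CommRing K] {n : ℕ} (F : MvPowerSeries ℕ K) (mu : Part n) :
    F.coeff (expo mu.1) = ∑ lam : Part n, schurCoeff K n F lam * (schur K lam.1).coeff (expo mu.1) := by
  have h : Matrix.vecMul (schurCoeff K n F) (kostka K n) = fun mu : Part n => F.coeff (expo mu.1) := by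
    change Matrix.vecMul (Matrix.vecMul _ _) _ = _
    rw [Matrix.vecMul_vecMul, Matrix.nonsing_inv_mul _ (by rw [kostka_det]; exact isUnit_one),
      Matrix.vecMul_one]
  exact (congrFun h mu).symm

theorem schurCoeff_unique (K : Type*) [CommRing K] {n : ℕ} (F : MvPowerSeries ℕ K) (A : Part n → K)
    (h : ∀ mu : Part n, F.coeff (expo mu.1) = ∑ lam : Part n, A lam * (schur K lam.1).coeff (expo mu.1)) :
    schurCoeff K n F = A := by
  have h' : (fun mu : Part n => F.coeff (expo mu.1)) = Matrix.vecMul A (kostka K n) := funext h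
  change Matrix.vecMul (fun mu : Part n => F.coeff (expo mu.1)) _ = _
  rw [h', Matrix.vecMul_vecMul, Matrix.mul_nonsing_inv _ (by rw [kostka_det]; exact isUnit_one),
    Matrix.vecMul_one]

theorem coeff_schur_of_card_ne (K : Type*) [CommRing K] (l m : YoungDiagram) (h : l.card ≠ m.card) : (schur K l).coeff (expo m) = 0 := by
  have : IsEmpty {T : SemistandardYoungTableau l // content T = expo m} := by
    refine ⟨fun ⟨T,hT⟩ => h ?_⟩
    rw [← degree_expo m, ← hT, content, map_sum]
    simp [YoungDiagram.card]
  change ((Nat.card _ : ℕ) : K) = 0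
  rw [Nat.card_of_isEmpty, Nat.cast_zero]

open Classical in
theorem schurCoeff_schur (K : Type*) [CommRing K] (l : YoungDiagram) (n) (p : Part n) : schurCoeff K n (schur K l) p = if l = p.1 then 1 else 0 := by
  rw [schurCoeff_unique K (n := n) (schur K l) (fun p => if l = p.1 then 1 else 0)]
  intro mu
  by_cases h : l.card = n
  · rw [Finset.sum_eq_single ⟨l, h⟩]
    · simp
    · intro b _ hb
      rw [if_neg, zero_mul]
      rintro rfl; exact hb rfl
    · simp
  · rw [coeff_schur_of_card_ne K l mu.1 (by rw [mu.2]; exact h), Finset.sum_eq_zero]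
    intro b _
    rw [if_neg, zero_mul]
    rintro rfl; exact h b.2

open Classical in
/-- The Schur functions are orthonormal for `hall`. -/
theorem hall_schur {K : Type*} [CommRing K] (l m : YoungDiagram) (F : SymSeries K) (f : SymFun K) (hF : F.1 = schur K l) (hf : f.1 = schur K m) :
   hall F f = if l = m then 1 else 0 := by
  change ∑ᶠ n : ℕ, ∑ lam : Part n, schurCoeff K n F.1 lam * schurCoeff K n f.1 lam = _
  rw [hF, hf, finsum_eq_single _ l.card]
  · rw [Finset.sum_eq_single ⟨l, rfl⟩]
    · simp [schurCoeff_schur, eq_comm]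
    · intro b _ hb
      rw [schurCoeff_schur, if_neg, zero_mul]
      rintro h; exact hb (Subtype.ext h.symm)
    · simp
  · intro n hn
    refine Finset.sum_eq_zero fun b _ => ?_
    rw [schurCoeff_schur, if_neg, zero_mul]
    rintro rfl; exact hn b.2.symm

/-! ### Two sets of variables, the coproduct, and the adjoint maps -/

section TwoSets

variable {K : Type*} [CommRing K]

instance : Filter.TendstoCofinite (Sum.inl : ℕ → ℕ ⊕ ℕ) :=
  Filter.tendstoCofinite_of_injective Sum.inl_injective

instance : Filter.TendstoCofinite (Sum.inr : ℕ → ℕ ⊕ ℕ) :=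
  Filter.tendstoCofinite_of_injective Sum.inr_injective

/-- `F(x) = F(x_0, x_1, …)`, as a power series in `x_0, x_1, …, y_0, y_1, …`
(`x_i` and `y_i` are the variables of index `Sum.inl i` and `Sum.inr i`). -/
def inX : MvPowerSeries ℕ K →ₐ[K] MvPowerSeries (ℕ ⊕ ℕ) K := MvPowerSeries.rename Sum.inl

/-- `F(y) = F(y_0, y_1, …)`. -/
def inY : MvPowerSeries ℕ K →ₐ[K] MvPowerSeries (ℕ ⊕ ℕ) K := MvPowerSeries.rename Sum.inr

/-- `F(x, y)`: the variables of `F` are replaced by `x_0, y_0, x_1, y_1, …`. For symmetric `F` the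
order in which the `x_i` and the `y_i` are listed does not matter. -/
def inXY : MvPowerSeries ℕ K →ₐ[K] MvPowerSeries (ℕ ⊕ ℕ) K :=
  MvPowerSeries.rename Equiv.natSumNatEquivNat.symm

theorem coeff_rename_equiv {α β : Type*} (e : α ≃ β) (F : MvPowerSeries α K) (d : α →₀ ℕ) :
    (MvPowerSeries.rename e F).coeff (d.mapDomain e) = F.coeff d := by
  have := MvPowerSeries.coeff_embDomain_rename e.toEmbedding F d
  rw [Finsupp.embDomain_eq_mapDomain] at this
  exact this

theorem coeff_perm {F : MvPowerSeries ℕ K} (hF : F ∈ SymSeries K) (σ : Equiv.Perm ℕ) (d : ℕ →₀ ℕ) :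
    F.coeff (d.mapDomain σ) = F.coeff d := by
  conv_lhs => rw [← hF σ]
  exact coeff_rename_equiv σ F d

theorem inXY_eq {F : MvPowerSeries ℕ K} (hF : F ∈ SymSeries K) (e : ℕ ≃ ℕ ⊕ ℕ) :
    MvPowerSeries.rename e F = inXY F := by
  conv_lhs => rw [← hF (Equiv.natSumNatEquivNat.symm.trans e.symm)]
  rw [MvPowerSeries.rename_rename, inXY]
  congr 2
  funext n
  simp

theorem coeff_inXY_perm {F : MvPowerSeries ℕ K} (hF : F ∈ SymSeries K) (σ τ : Equiv.Perm ℕ)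
    (d e : ℕ →₀ ℕ) :
    (inXY F).coeff ((d.mapDomain σ).sumElim (e.mapDomain τ)) = (inXY F).coeff (d.sumElim e) := by
  have h1 : (d.mapDomain σ).sumElim (e.mapDomain τ)
      = (d.sumElim e).mapDomain (Equiv.sumCongr σ τ) := by
    rw [Finsupp.sumElim_eq_add, Finsupp.sumElim_eq_add, Finsupp.mapDomain_add,
      ← Finsupp.mapDomain_comp, ← Finsupp.mapDomain_comp, ← Finsupp.mapDomain_comp,
      ← Finsupp.mapDomain_comp]
    rfl
  have h2 : MvPowerSeries.rename (Equiv.sumCongr σ τ) (inXY F) = inXY F := by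
    conv_rhs => rw [← inXY_eq hF (Equiv.natSumNatEquivNat.symm.trans (Equiv.sumCongr σ τ))]
    rw [inXY, MvPowerSeries.rename_rename]
    rfl
  rw [h1]
  conv_lhs => rw [← h2]
  exact coeff_rename_equiv _ _ _

theorem coeff_inX_mul_inY (F G : MvPowerSeries ℕ K) (d e : ℕ →₀ ℕ) :
    (inX F * inY G).coeff (d.sumElim e) = F.coeff d * G.coeff e := by
  classical
  have hX : (inX F).coeff (d.mapDomain Sum.inl) = F.coeff d := by
    have := MvPowerSeries.coeff_embDomain_rename (Function.Embedding.inl : ℕ ↪ ℕ ⊕ ℕ) F d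
    rw [Finsupp.embDomain_eq_mapDomain] at this
    exact this
  have hY : (inY G).coeff (e.mapDomain Sum.inr) = G.coeff e := by
    have := MvPowerSeries.coeff_embDomain_rename (Function.Embedding.inr : ℕ ↪ ℕ ⊕ ℕ) G e
    rw [Finsupp.embDomain_eq_mapDomain] at this
    exact this
  rw [MvPowerSeries.coeff_mul,
    Finset.sum_eq_single (d.mapDomain Sum.inl, e.mapDomain Sum.inr), hX, hY]
  · rintro ⟨a, b⟩ hp hne
    rw [Finset.HasAntidiagonal.mem_antidiagonal] at hp
    by_cases ha : a ∈ Set.range (Finsupp.mapDomain (Sum.inl : ℕ → ℕ ⊕ ℕ) (M := ℕ))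
    · by_cases hb : b ∈ Set.range (Finsupp.mapDomain (Sum.inr : ℕ → ℕ ⊕ ℕ) (M := ℕ))
      · obtain ⟨a, rfl⟩ := ha
        obtain ⟨b, rfl⟩ := hb
        rw [← Finsupp.sumElim_eq_add] at hp
        have h1 : a = d := by
          ext i
          exact DFunLike.congr_fun hp (Sum.inl i)
        have h2 : b = e := by
          ext i
          exact DFunLike.congr_fun hp (Sum.inr i)
        subst h1 h2
        exact absurd rfl hne
      · rw [inY, MvPowerSeries.coeff_rename_eq_zero _ _ hb, mul_zero]
    · rw [inX, MvPowerSeries.coeff_rename_eq_zero _ _ ha, zero_mul]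
  · intro h
    rw [Finset.HasAntidiagonal.mem_antidiagonal, ← Finsupp.sumElim_eq_add] at h
    exact absurd rfl h

/-- Exponent vectors up to a permutation of the variables. -/
def orbitSetoid : Setoid (ℕ →₀ ℕ) where
  r d e := ∃ σ : Equiv.Perm ℕ, d.mapDomain σ = e
  iseqv :=
    { refl := fun d => ⟨1, Finsupp.mapDomain_id⟩
      symm := by
        rintro d _ ⟨σ, rfl⟩
        refine ⟨σ.symm, ?_⟩
        rw [← Finsupp.mapDomain_comp]
        convert! Finsupp.mapDomain_id
        simp
      trans := by
        rintro d _ _ ⟨σ, rfl⟩ ⟨τ, rfl⟩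
        exact ⟨σ.trans τ, by rw [← Finsupp.mapDomain_comp]; rfl⟩ }

abbrev Orbit : Type := Quotient orbitSetoid

theorem coeff_orbit {F : MvPowerSeries ℕ K} (hF : F ∈ SymSeries K) {d e : ℕ →₀ ℕ}
    (h : (Quotient.mk orbitSetoid d) = Quotient.mk orbitSetoid e) : F.coeff d = F.coeff e := by
  obtain ⟨σ, rfl⟩ := Quotient.exact h
  exact (coeff_perm hF σ d).symm

theorem coeff_inXY_orbit {F : MvPowerSeries ℕ K} (hF : F ∈ SymSeries K) {d e d' e' : ℕ →₀ ℕ}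
    (h : (Quotient.mk orbitSetoid d) = Quotient.mk orbitSetoid d')
    (h' : (Quotient.mk orbitSetoid e) = Quotient.mk orbitSetoid e') :
    (inXY F).coeff (d.sumElim e) = (inXY F).coeff (d'.sumElim e') := by
  obtain ⟨σ, rfl⟩ := Quotient.exact h
  obtain ⟨τ, rfl⟩ := Quotient.exact h'
  exact (coeff_inXY_perm hF σ τ d e).symm

theorem degree_orbit {d e : ℕ →₀ ℕ}
    (h : (Quotient.mk orbitSetoid d) = Quotient.mk orbitSetoid e) : d.degree = e.degree := by
  obtain ⟨σ, rfl⟩ := Quotient.exact h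
  exact (Finsupp.degree_mapDomain σ d).symm

open Classical in
/-- The monomial symmetric function: the sum of all monomials in one orbit. -/
def msym (K : Type*) [CommRing K] (q : Orbit) : SymFun K :=
  ⟨fun d => if Quotient.mk orbitSetoid d = q then 1 else 0, by
    set F : MvPowerSeries ℕ K := fun d => if Quotient.mk orbitSetoid d = q then 1 else 0
    constructor
    · intro σ
      ext d
      obtain ⟨d, rfl⟩ : ∃ d', Finsupp.mapDomain σ d' = d := by
        refine ⟨d.mapDomain σ.symm, ?_⟩
        rw [← Finsupp.mapDomain_comp]
        convert! Finsupp.mapDomain_id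
        simp
      rw [coeff_rename_equiv]
      have : Quotient.mk orbitSetoid d = Quotient.mk orbitSetoid (d.mapDomain σ) :=
        Quotient.sound ⟨σ, rfl⟩
      change (if _ then (1 : K) else 0) = if _ then 1 else 0
      rw [this]
    · refine ⟨q.out.degree, fun d hd => if_neg fun h => ?_⟩
      rw [degree_orbit (h.trans (Quotient.out_eq q).symm)] at hd
      exact lt_irrefl _ hd⟩

open Classical in
theorem coeff_msym (q : Orbit) (d : ℕ →₀ ℕ) :
    MvPowerSeries.coeff d (msym K q : MvPowerSeries ℕ K) =
      if Quotient.mk orbitSetoid d = q then 1 else 0 := rfl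

theorem finite_orbits (N : ℕ) : {q : Orbit | q.out.degree ≤ N}.Finite := by
  have hfin : (⋃ n ∈ Finset.range (N + 1),
      (((Finset.range N).finsuppAntidiag n : Finset (ℕ →₀ ℕ)) : Set (ℕ →₀ ℕ))).Finite :=
    Set.Finite.biUnion (Finset.finite_toSet _) fun _ _ => Finset.finite_toSet _
  refine (hfin.image (Quotient.mk orbitSetoid)).subset fun q hq => ?_
  set d := q.out with hd
  have hq' : d.degree ≤ N := hq
  have hcard : d.support.card ≤ N := by
    refine le_trans ?_ hq'
    rw [Finsupp.degree_apply, Finset.card_eq_sum_ones]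
    exact Finset.sum_le_sum fun i hi => Nat.one_le_iff_ne_zero.2 (Finsupp.mem_support_iff.1 hi)
  let a : Fin d.support.card ↪ ℕ :=
    d.support.equivFin.symm.toEmbedding.trans (Function.Embedding.subtype _)
  have := Equiv.Perm.isMultiplyPretransitive ℕ d.support.card
  obtain ⟨σ, hσ⟩ := MulAction.exists_smul_eq (Equiv.Perm ℕ) a Fin.valEmbedding
  refine ⟨d.mapDomain σ, ?_, ?_⟩
  · simp only [Set.mem_iUnion, Finset.mem_coe, Finset.mem_finsuppAntidiag]
    refine ⟨d.degree, by simpa [Nat.lt_succ_iff] using hq', ?_⟩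
    have hs : (d.mapDomain σ).support ⊆ Finset.range N := by
      refine Finsupp.mapDomain_support.trans fun x hx => ?_
      obtain ⟨i, hi, rfl⟩ := Finset.mem_image.1 hx
      have := DFunLike.congr_fun hσ (d.support.equivFin ⟨i, hi⟩)
      have h2 : σ i = (d.support.equivFin ⟨i, hi⟩ : ℕ) := by
        simpa [a] using this
      rw [h2, Finset.mem_range]
      exact (Fin.is_lt _).trans_le hcard
    refine ⟨?_, hs⟩
    rw [← Finsupp.degree_mapDomain σ d, Finsupp.degree_apply]
    exact (Finset.sum_subset hs fun i _ hi => by simpa using hi).symm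
  · rw [← Quotient.out_eq q]
    exact (Quotient.sound ⟨σ, rfl⟩ : Quotient.mk orbitSetoid d = _).symm

theorem linearIndependent_msym : LinearIndependent K (msym K) := by
  rw [linearIndependent_iff]
  intro l hl
  ext q
  have := congrArg (fun f : SymFun K => MvPowerSeries.coeff q.out (f : MvPowerSeries ℕ K)) hl
  simp only [Finsupp.linearCombination_apply, Finsupp.sum, AddSubmonoidClass.coe_finsetSum,
    Subalgebra.coe_smul, map_sum, map_smul, coeff_msym, Quotient.out_eq] at this
  simpa [Finsupp.sum] using this

theorem span_msym : (⊤ : Submodule K (SymFun K)) ≤ Submodule.span K (Set.range (msym K)) := by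
  rintro ⟨f, hf, N, hN⟩ -
  have h : (⟨f, hf, N, hN⟩ : SymFun K) =
      ∑ q ∈ (finite_orbits N).toFinset, f.coeff q.out • msym K q := by
    classical
    apply Subtype.ext
    ext d
    simp only [AddSubmonoidClass.coe_finsetSum, Subalgebra.coe_smul, map_sum, map_smul, coeff_msym,
      smul_eq_mul, mul_ite, mul_one, mul_zero, Finset.sum_ite_eq, Set.Finite.mem_toFinset,
      Set.mem_ofPred_eq]
    have hd : Quotient.mk orbitSetoid (Quotient.mk orbitSetoid d).out = Quotient.mk orbitSetoid d :=
      Quotient.out_eq _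
    split_ifs with h
    · exact (coeff_orbit hf hd).symm
    · rw [degree_orbit hd] at h
      exact hN d (not_le.1 h)
  rw [h]
  exact Submodule.sum_mem _ fun q _ => Submodule.smul_mem _ _ (Submodule.subset_span ⟨q, rfl⟩)

/-- The basis of monomial symmetric functions. -/
def msymBasis (K : Type*) [CommRing K] : Module.Basis Orbit K (SymFun K) :=
  Module.Basis.mk linearIndependent_msym span_msym

/-- The map from the tensor product `Λ(x) ⊗ Λ(y)` to the power series in `x` and `y`,
`f ⊗ g ↦ f(x) g(y)`. -/
def tensorToXY (K : Type*) [CommRing K] :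
    SymFun K ⊗[K] SymFun K →ₐ[K] MvPowerSeries (ℕ ⊕ ℕ) K :=
  Algebra.TensorProduct.productMap (inX.comp (SymFun K).val) (inY.comp (SymFun K).val)

theorem tensorToXY_tmul (f g : SymFun K) : tensorToXY K (f ⊗ₜ g) = inX f.1 * inY g.1 :=
  Algebra.TensorProduct.productMap_apply_tmul _ _ _ _

theorem tensorToXY_injective : Function.Injective (tensorToXY K) := by
  classical
  let b := (msymBasis K).tensorProduct (msymBasis K)
  have hc : ∀ p : Orbit × Orbit, (MvPowerSeries.coeff (p.1.out.sumElim p.2.out)).comp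
      (tensorToXY K).toLinearMap = b.coord p := by
    intro p
    refine b.ext fun r => ?_
    rw [Module.Basis.coord_apply, Module.Basis.repr_self, LinearMap.comp_apply,
      AlgHom.toLinearMap_apply, Module.Basis.tensorProduct_apply, tensorToXY_tmul,
      coeff_inX_mul_inY, msymBasis, Module.Basis.mk_apply, Module.Basis.mk_apply, coeff_msym,
      coeff_msym, Quotient.out_eq, Quotient.out_eq, Finsupp.single_apply]
    rcases p with ⟨p1, p2⟩
    rcases r with ⟨r1, r2⟩
    simp only [Prod.mk.injEq, ← ite_and, mul_ite, mul_one, mul_zero, eq_comm]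
    congr 1
    simp [and_comm]
  rw [injective_iff_map_eq_zero]
  intro t ht
  refine b.repr.injective (Finsupp.ext fun p => ?_)
  rw [map_zero, Finsupp.zero_apply, ← Module.Basis.coord_apply, ← hc p, LinearMap.comp_apply,
    AlgHom.toLinearMap_apply, ht, map_zero]

theorem inXY_mem_range (f : SymFun K) : inXY f.1 ∈ (tensorToXY K).range := by
  classical
  obtain ⟨f, hf, N, hN⟩ := f
  let S := (finite_orbits N).toFinset
  refine ⟨∑ p ∈ S ×ˢ S, (inXY f).coeff (p.1.out.sumElim p.2.out) • (msym K p.1 ⊗ₜ[K] msym K p.2), ?_⟩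
  have hbig : ∀ d e : ℕ →₀ ℕ, N < d.degree + e.degree → (inXY f).coeff (d.sumElim e) = 0 := by
    intro d e h
    have h1 : ((d.sumElim e).mapDomain Equiv.natSumNatEquivNat).mapDomain
        Equiv.natSumNatEquivNat.symm = d.sumElim e := by
      rw [← Finsupp.mapDomain_comp]
      rw [Equiv.symm_comp_self, Finsupp.mapDomain_id]
    rw [← h1, inXY, coeff_rename_equiv]
    refine hN _ ?_
    rwa [Finsupp.degree_mapDomain, Finsupp.sumElim_eq_add, map_add, Finsupp.degree_mapDomain,
      Finsupp.degree_mapDomain]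
  ext u
  obtain ⟨d, e, rfl⟩ : ∃ d e : ℕ →₀ ℕ, d.sumElim e = u := by
    refine ⟨u.comapDomain Sum.inl Sum.inl_injective.injOn,
      u.comapDomain Sum.inr Sum.inr_injective.injOn, ?_⟩
    ext (i | i) <;> rfl
  have hd : Quotient.mk orbitSetoid (Quotient.mk orbitSetoid d).out = Quotient.mk orbitSetoid d :=
    Quotient.out_eq _
  have he : Quotient.mk orbitSetoid (Quotient.mk orbitSetoid e).out = Quotient.mk orbitSetoid e :=
    Quotient.out_eq _
  change MvPowerSeries.coeff _ (tensorToXY K _) = _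
  simp only [map_sum, map_smul, tensorToXY_tmul, coeff_inX_mul_inY, coeff_msym, smul_eq_mul]
  have hp : ∀ p ∈ S ×ˢ S, ((inXY f).coeff (p.1.out.sumElim p.2.out) *
      ((if Quotient.mk orbitSetoid d = p.1 then 1 else 0) *
        (if Quotient.mk orbitSetoid e = p.2 then 1 else 0))) =
      if (Quotient.mk orbitSetoid d, Quotient.mk orbitSetoid e) = p then
        (inXY f).coeff (p.1.out.sumElim p.2.out) else 0 := by
    rintro ⟨p, q⟩ -
    simp only [Prod.mk.injEq, ite_and, mul_ite, mul_one, mul_zero]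
    split_ifs <;> rfl
  rw [Finset.sum_congr rfl hp, Finset.sum_ite_eq]
  have hde := coeff_inXY_orbit hf hd he
  split_ifs with h
  · exact hde
  · refine (hbig d e ?_).symm
    simp only [Finset.mem_product, S, Set.Finite.mem_toFinset, Set.mem_ofPred_eq,
      degree_orbit hd, degree_orbit he] at h
    omega

/-- The coproduct of symmetric functions: `f(x) ↦ f(x, y)`,
viewed in the tensor product `Λ(x) ⊗ Λ(y)`. -/
def coproduct (K : Type*) [CommRing K] : SymFun K →ₐ[K] SymFun K ⊗[K] SymFun K :=
  (AlgEquiv.ofInjective (tensorToXY K) tensorToXY_injective).symm.toAlgHom.comp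
    ((inXY.comp (SymFun K).val).codRestrict (tensorToXY K).range inXY_mem_range)

theorem tensorToXY_coproduct (f : SymFun K) : tensorToXY K (coproduct K f) = inXY f.1 := by
  exact congrArg Subtype.val ((AlgEquiv.ofInjective (tensorToXY K) tensorToXY_injective).apply_symm_apply
    ⟨inXY f.1, inXY_mem_range f⟩)

/-- The map `F^⊥ = ((F, -) ⊗ id) ∘ Δ`, that is `f ↦ ∑ (F, f₁) f₂` where `Δ f = ∑ f₁ ⊗ f₂`. -/
def perp (F : SymSeries K) : SymFun K →ₗ[K] SymFun K :=
  (TensorProduct.lid K (SymFun K)).toLinearMap ∘ₗ (hall F).rTensor (SymFun K) ∘ₗ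
    (coproduct K).toLinearMap

/-- `F` is group-like: `F(x, y) = F(x) F(y)` and `F(0) = 1`. -/
def IsGroupLike (F : SymSeries K) : Prop :=
  inXY F.1 = inX F.1 * inY F.1 ∧ MvPowerSeries.constantCoeff F.1 = 1

end TwoSets

end SymmFn

end

open scoped TensorProduct

noncomputable section

namespace SymmFn

/-! ### Horizontal strips -/

/-! Write h_d for the product of the complete symmetric functions h_{d_i}. Everything rests on the
duality (F, h_d) = [x^d] F (`hall_completeProd`) and on the fact that the h_d span Λ
(`span_completeProd`).

Since h_d h_e = h_u, where u lists the exponents of d and e together, (F, h_d h_e) is the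
coefficient of x^d y^e in F(x, y), while (F, h_d)(F, h_e) is that of F(x)F(y). Comparing them gives
the multiplicative part of 1 ⇔ 2 (`inXY_eq_mul_iff`); the unit is (F, 1) = F(0).

If (F, -) is an algebra homomorphism, so is F^⊥, being a composite of such. As F(0) = 1, F^⊥ is the
identity plus terms of lower degree, hence bijective (`perp_bijective`). Conversely, the constant
term of F^⊥ f is (F, f) (`constantCoeff_perp`), so (F, -) is an algebra homomorphism as soon as F^⊥
is.

The pairing is defined through Schur functions, so the duality needs the expansion h_d = ∑ [x^d] s_λ
· s_λ (`completeProd_eq_sum`). It follows by comparing the iterated Pieri rule with the branching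
rule for tableaux: both run over chains of horizontal strips. The Pieri rule itself is checked one
variable at a time by branching, which reduces it to the commutation of adding and removing
horizontal strips (`sum_above_below`), proved by an explicit bijection on row lengths. -/

theorem rowLen_injective : Function.Injective YoungDiagram.rowLen := by
  intro a b h
  exact expo_injective (Finsupp.ext fun i => congrFun h i)

theorem exists_rowLen_eq_zero (lam : YoungDiagram) : ∃ N, ∀ i, N ≤ i → lam.rowLen i = 0 := by
  refine ⟨lam.colLen 0, fun i hi => ?_⟩
  by_contra h
  have h' : (i, 0) ∈ lam := YoungDiagram.mem_iff_lt_rowLen.2 (Nat.pos_of_ne_zero h)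
  have := YoungDiagram.mem_iff_lt_colLen.1 h'
  omega

theorem card_eq_sum_rowLen {lam : YoungDiagram} {N : ℕ} (h : ∀ i, N ≤ i → lam.rowLen i = 0) :
    lam.card = ∑ i ∈ Finset.range N, lam.rowLen i := by
  rw [← degree_expo, Finsupp.degree_apply]
  refine Finset.sum_subset (fun i hi => ?_) fun i _ hi => by simpa using hi
  by_contra hN
  exact Finsupp.mem_support_iff.1 hi (h i (by simpa using hN))

theorem exists_rowLen_eq {f : ℕ → ℕ} (hf : Antitone f) {N : ℕ} (hN : f N = 0) :
    ∃ lam : YoungDiagram, lam.rowLen = f := by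
  let s : Finset (ℕ × ℕ) := (Finset.range N ×ˢ Finset.range (f 0)).filter fun c => c.2 < f c.1
  have hs : ∀ i j, (i, j) ∈ s ↔ j < f i := by
    intro i j
    simp only [s, Finset.mem_filter, Finset.mem_product, Finset.mem_range, and_iff_right_iff_imp]
    refine fun h => ⟨?_, h.trans_le (hf (Nat.zero_le i))⟩
    by_contra hi
    have := hf (not_lt.1 hi)
    omega
  refine ⟨⟨s, fun a b hab ha => ?_⟩, funext fun i => ?_⟩
  · obtain ⟨a1, a2⟩ := a
    obtain ⟨b1, b2⟩ := b
    have h1 : b1 ≤ a1 := hab.1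
    have h2 : b2 ≤ a2 := hab.2
    have h3 := (hs a1 a2).1 ha
    exact (hs b1 b2).2 ((h2.trans_lt h3).trans_le (hf h1))
  · refine eq_of_forall_lt_iff fun j => ?_
    rw [← YoungDiagram.mem_iff_lt_rowLen]
    exact hs i j

/-- `mu` is contained in `lam` and `lam / mu` is a horizontal strip. -/
def IsStrip (mu lam : YoungDiagram) : Prop :=
  ∀ i, mu.rowLen i ≤ lam.rowLen i ∧ lam.rowLen (i + 1) ≤ mu.rowLen i

theorem IsStrip.cells_subset {mu lam : YoungDiagram} (h : IsStrip mu lam) : mu.cells ⊆ lam.cells := by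
  rintro ⟨i, j⟩ hc
  have hc' : (i, j) ∈ mu := hc
  rw [YoungDiagram.mem_iff_lt_rowLen] at hc'
  have : (i, j) ∈ lam := YoungDiagram.mem_iff_lt_rowLen.2 (hc'.trans_le (h i).1)
  exact this

theorem card_le_of_isStrip {mu lam : YoungDiagram} (h : IsStrip mu lam) : mu.card ≤ lam.card :=
  Finset.card_le_card h.cells_subset

/-- The diagrams with `n` cells. -/
def diagrams (n : ℕ) : Finset YoungDiagram :=
  Finset.univ.map (Function.Embedding.subtype fun lam : YoungDiagram => lam.card = n)

@[simp]
theorem mem_diagrams {n : ℕ} {lam : YoungDiagram} : lam ∈ diagrams n ↔ lam.card = n := by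
  simp [diagrams]

open Classical in
/-- The diagrams obtained from `lam` by adding a horizontal strip of size `k`. -/
def above (lam : YoungDiagram) (k : ℕ) : Finset YoungDiagram :=
  (diagrams (lam.card + k)).filter (IsStrip lam)

open Classical in
/-- The diagrams obtained from `lam` by removing a horizontal strip of size `k`. -/
def below (lam : YoungDiagram) (k : ℕ) : Finset YoungDiagram :=
  -- The equation `mu.card + k = lam.card` makes the set empty when `k > lam.card`, where the
  -- subtraction truncates to 0.
  (diagrams (lam.card - k)).filter fun mu => mu.card + k = lam.card ∧ IsStrip mu lam

theorem mem_above {lam mu : YoungDiagram} {k : ℕ} :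
    mu ∈ above lam k ↔ mu.card = lam.card + k ∧ IsStrip lam mu := by
  simp [above]

theorem mem_below {lam mu : YoungDiagram} {k : ℕ} :
    mu ∈ below lam k ↔ lam.card = mu.card + k ∧ IsStrip mu lam := by
  simp only [below, Finset.mem_filter, mem_diagrams]
  constructor
  · rintro ⟨_, h, h'⟩
    exact ⟨h.symm, h'⟩
  · rintro ⟨h, h'⟩
    exact ⟨by omega, h.symm, h'⟩

theorem mem_below_iff_mem_above {lam mu : YoungDiagram} {k : ℕ} :
    mu ∈ below lam k ↔ lam ∈ above mu k := by
  rw [mem_below, mem_above]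

/-! ### The local growth bijection and the commutation of strips -/

/-- The diagram with the given row lengths, if there is one. -/
def ofRows (f : ℕ → ℕ) : YoungDiagram :=
  open Classical in if h : ∃ lam : YoungDiagram, lam.rowLen = f then h.choose else ⊥

theorem rowLen_ofRows {f : ℕ → ℕ} (hf : Antitone f) {N : ℕ} (hN : f N = 0) (i : ℕ) :
    (ofRows f).rowLen i = f i := by
  have h := exists_rowLen_eq hf hN
  rw [ofRows, dif_pos h, h.choose_spec]

theorem ofRows_rowLen (lam : YoungDiagram) : ofRows lam.rowLen = lam := by
  have h : ∃ mu : YoungDiagram, mu.rowLen = lam.rowLen := ⟨lam, rfl⟩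
  rw [ofRows, dif_pos h]
  exact rowLen_injective h.choose_spec

/-- Given `nu` containing `lam` and `mu`, the row lengths of the diagram contained in `lam` and `mu`
that corresponds to it under the local growth rule. -/
def growDown (lam mu nu : YoungDiagram) (i : ℕ) : ℕ :=
  max (lam.rowLen (i + 1)) (mu.rowLen (i + 1)) + min (lam.rowLen i) (mu.rowLen i) - nu.rowLen (i + 1)

/-- The inverse of `growDown`, where `k` is the excess in the first row. -/
def growUp (lam mu kap : YoungDiagram) (k : ℕ) : ℕ → ℕ
  | 0 => max (lam.rowLen 0) (mu.rowLen 0) + k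
  | i + 1 => max (lam.rowLen (i + 1)) (mu.rowLen (i + 1)) + min (lam.rowLen i) (mu.rowLen i) -
      kap.rowLen i

/-- The strip conditions confine ν_{i+1} to the interval from max(λ_{i+1}, μ_{i+1}) to min(λ_i,
μ_i), and confine row i of a diagram below both to the same interval. `growDown` reflects ν_{i+1} in
it, so the subtraction never truncates. The intervals descend as i grows, so the reflected rows
again form a diagram. -/
theorem rowLen_growDown {lam mu nu : YoungDiagram} (h1 : IsStrip lam nu) (h2 : IsStrip mu nu)
    (i : ℕ) : (ofRows (growDown lam mu nu)).rowLen i = growDown lam mu nu i := by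
  obtain ⟨N, hN⟩ := exists_rowLen_eq_zero lam
  obtain ⟨M, hM⟩ := exists_rowLen_eq_zero mu
  refine rowLen_ofRows (N := N + M) (antitone_nat_of_succ_le fun i => ?_) ?_ i
  · have := h1 i
    have := h1 (i + 1)
    have := h2 i
    have := h2 (i + 1)
    have := h1 (i + 1 + 1)
    have := h2 (i + 1 + 1)
    simp only [growDown]
    omega
  · have := hN (N + M) (by omega)
    have := hN (N + M + 1) (by omega)
    have := hM (N + M) (by omega)
    have := hM (N + M + 1) (by omega)
    simp only [growDown]
    omega

theorem rowLen_growUp {lam mu kap : YoungDiagram} (k : ℕ) (h1 : IsStrip kap lam)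
    (h2 : IsStrip kap mu) (i : ℕ) :
    (ofRows (growUp lam mu kap k)).rowLen i = growUp lam mu kap k i := by
  obtain ⟨N, hN⟩ := exists_rowLen_eq_zero lam
  obtain ⟨M, hM⟩ := exists_rowLen_eq_zero mu
  -- Row i + 1 of `growUp` involves row i of `lam` and `mu`, so it is only sure to vanish one index
  -- later than they do.
  refine rowLen_ofRows (N := N + M + 1) (antitone_nat_of_succ_le fun i => ?_) ?_ i
  · have := h1 i
    have := h2 i
    rcases i with _ | i
    · simp only [growUp]
      omega
    · have := h1 (i + 1)
      have := h2 (i + 1)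
      have := h1 i
      have := h2 i
      simp only [growUp]
      omega
  · have := hN (N + M) (by omega)
    have := hN (N + M + 1) (by omega)
    have := hM (N + M) (by omega)
    have := hM (N + M + 1) (by omega)
    simp only [growUp]
    omega

/-- Sum the row identities: with the maximum in row 0 supplied by `h0`, all maxima and all minima
occur once, and max + min = λ_i + μ_i. -/
theorem card_of_growth {lam mu nu kap : YoungDiagram} {k : ℕ}
    (h0 : nu.rowLen 0 = max (lam.rowLen 0) (mu.rowLen 0) + k)
    (h : ∀ i, kap.rowLen i + nu.rowLen (i + 1) =
      max (lam.rowLen (i + 1)) (mu.rowLen (i + 1)) + min (lam.rowLen i) (mu.rowLen i)) :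
    kap.card + nu.card = lam.card + mu.card + k := by
  obtain ⟨N1, h1⟩ := exists_rowLen_eq_zero lam
  obtain ⟨N2, h2⟩ := exists_rowLen_eq_zero mu
  obtain ⟨N3, h3⟩ := exists_rowLen_eq_zero nu
  obtain ⟨N4, h4⟩ := exists_rowLen_eq_zero kap
  set N := N1 + N2 + N3 + N4 with hN
  rw [card_eq_sum_rowLen (lam := lam) (N := N + 1) fun i hi => h1 i (by omega),
    card_eq_sum_rowLen (lam := mu) (N := N + 1) fun i hi => h2 i (by omega),
    card_eq_sum_rowLen (lam := nu) (N := N + 1) fun i hi => h3 i (by omega),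
    card_eq_sum_rowLen (lam := kap) (N := N) fun i hi => h4 i (by omega),
    Finset.sum_range_succ' (fun i => nu.rowLen i), h0, ← add_assoc, ← Finset.sum_add_distrib,
    ← Finset.sum_add_distrib, Finset.sum_congr rfl fun i _ => h i, Finset.sum_add_distrib]
  have e1 : ∑ i ∈ Finset.range (N + 1), max (lam.rowLen i) (mu.rowLen i) =
      ∑ i ∈ Finset.range N, max (lam.rowLen (i + 1)) (mu.rowLen (i + 1)) +
        max (lam.rowLen 0) (mu.rowLen 0) := Finset.sum_range_succ' _ _
  have e2 : ∑ i ∈ Finset.range (N + 1), min (lam.rowLen i) (mu.rowLen i) =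
      ∑ i ∈ Finset.range N, min (lam.rowLen i) (mu.rowLen i) := by
    rw [Finset.sum_range_succ, h1 N (by omega), Nat.zero_min, add_zero]
  have e3 : ∑ i ∈ Finset.range (N + 1), (lam.rowLen i + mu.rowLen i) =
      ∑ i ∈ Finset.range (N + 1), max (lam.rowLen i) (mu.rowLen i) +
        ∑ i ∈ Finset.range (N + 1), min (lam.rowLen i) (mu.rowLen i) := by
    rw [← Finset.sum_add_distrib]
    exact Finset.sum_congr rfl fun i _ => (max_add_min _ _).symm
  omega

/-- Adding a horizontal strip and then removing one is the same as removing a horizontal strip and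
then adding one, up to the loss of a common number of cells. -/
theorem sum_above_below {M : Type*} [AddCommMonoid M] (lam : YoungDiagram) (a b : ℕ)
    (f : YoungDiagram → M) :
    ∑ nu ∈ above lam a, ∑ mu ∈ below nu b, f mu =
      ∑ k ∈ Finset.range (min a b + 1), ∑ kap ∈ below lam (b - k), ∑ mu ∈ above kap (a - k), f mu := by
  simp only [Finset.sum_sigma']
  -- The diagram `mu` is kept. The upper diagram `nu` is traded for the excess k of its first row
  -- over max(λ_0, μ_0), which is unconstrained above, and for the lower diagram obtained by
  -- reflecting the other rows.
  refine Finset.sum_bij'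
    (fun p _ => ⟨p.1.rowLen 0 - max (lam.rowLen 0) (p.2.rowLen 0),
      ofRows (growDown lam p.2 p.1), p.2⟩)
    (fun q _ => ⟨ofRows (growUp lam q.2.2 q.2.1 q.1), q.2.2⟩) ?_ ?_ ?_ ?_ ?_
  · rintro ⟨nu, mu⟩ h
    simp only [Finset.mem_sigma, mem_above, mem_below] at h
    obtain ⟨⟨c1, h1⟩, c2, h2⟩ := h
    have hr := rowLen_growDown h1 h2
    have e := card_of_growth (lam := lam) (mu := mu) (nu := nu)
      (kap := ofRows (growDown lam mu nu))
      (k := nu.rowLen 0 - max (lam.rowLen 0) (mu.rowLen 0))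
      (by have := h1 0; have := h2 0; omega)
      (fun i => by
        have := h1 i; have := h2 i; have := h1 (i + 1); have := h2 (i + 1)
        rw [hr, growDown]
        omega)
    have s1 : IsStrip (ofRows (growDown lam mu nu)) lam := by
      intro i
      have := h1 i; have := h2 i; have := h1 (i + 1); have := h2 (i + 1)
      rw [hr, growDown]
      omega
    have s2 : IsStrip (ofRows (growDown lam mu nu)) mu := by
      intro i
      have := h1 i; have := h2 i; have := h1 (i + 1); have := h2 (i + 1)
      rw [hr, growDown]
      omega
    -- By the cell count `e`, containment in `lam` gives k ≤ b and containment in `mu` gives k ≤ a.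
    have k1 : (ofRows (growDown lam mu nu)).card ≤ lam.card := card_le_of_isStrip s1
    have k2 : (ofRows (growDown lam mu nu)).card ≤ mu.card := card_le_of_isStrip s2
    simp only [Finset.mem_sigma, mem_above, mem_below, Finset.mem_range]
    refine ⟨by omega, ⟨by omega, s1⟩, by omega, s2⟩
  · rintro ⟨k, kap, mu⟩ h
    simp only [Finset.mem_sigma, mem_above, mem_below, Finset.mem_range] at h
    obtain ⟨hk, ⟨c1, h1⟩, c2, h2⟩ := h
    have hr := rowLen_growUp k h1 h2
    have e := card_of_growth (lam := lam) (mu := mu) (nu := ofRows (growUp lam mu kap k))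
      (kap := kap) (k := k) (hr 0)
      (fun i => by
        have := h1 i; have := h2 i
        rw [hr, growUp]
        omega)
    have s1 : IsStrip lam (ofRows (growUp lam mu kap k)) := by
      intro i
      have := h1 i; have := h2 i
      rw [hr, hr]
      rcases i with _ | i
      · simp only [growUp]; omega
      · have := h1 (i + 1); have := h2 (i + 1); have := h1 i; have := h2 i
        simp only [growUp]
        omega
    have s2 : IsStrip mu (ofRows (growUp lam mu kap k)) := by
      intro i
      have := h1 i; have := h2 i
      rw [hr, hr]
      rcases i with _ | i
      · simp only [growUp]; omega
      · have := h1 (i + 1); have := h2 (i + 1); have := h1 i; have := h2 i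
        simp only [growUp]
        omega
    simp only [Finset.mem_sigma, mem_above, mem_below]
    refine ⟨⟨by omega, s1⟩, by omega, s2⟩
  · rintro ⟨nu, mu⟩ h
    simp only [Finset.mem_sigma, mem_above, mem_below] at h
    obtain ⟨⟨c1, h1⟩, c2, h2⟩ := h
    have hr := rowLen_growDown h1 h2
    have : growUp lam mu (ofRows (growDown lam mu nu))
        (nu.rowLen 0 - max (lam.rowLen 0) (mu.rowLen 0)) = nu.rowLen := by
      funext i
      rcases i with _ | i
      · have := h1 0; have := h2 0
        simp only [growUp]; omega
      · have := h1 i; have := h2 i; have := h1 (i + 1); have := h2 (i + 1)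
        simp only [growUp, hr, growDown]
        omega
    simp only [this, ofRows_rowLen]
  · rintro ⟨k, kap, mu⟩ h
    simp only [Finset.mem_sigma, mem_above, mem_below, Finset.mem_range] at h
    obtain ⟨hk, ⟨c1, h1⟩, c2, h2⟩ := h
    have hr := rowLen_growUp k h1 h2
    have e1 : growDown lam mu (ofRows (growUp lam mu kap k)) = kap.rowLen := by
      funext i
      have := h1 i; have := h2 i
      simp only [growDown, hr, growUp]
      omega
    have e2 : (ofRows (growUp lam mu kap k)).rowLen 0 - max (lam.rowLen 0) (mu.rowLen 0) = k := by
      rw [hr, growUp]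
      omega
    simp only [e1, e2, ofRows_rowLen]
  · rintro ⟨nu, mu⟩ _
    rfl

/-! ### The branching rule for semistandard tableaux -/

theorem isStrip_iff {mu lam : YoungDiagram} : IsStrip mu lam ↔
    ∀ i j, ((i, j) ∈ mu → (i, j) ∈ lam) ∧ ((i + 1, j) ∈ lam → (i, j) ∈ mu) := by
  simp only [YoungDiagram.mem_iff_lt_rowLen, IsStrip]
  refine forall_congr' fun i => ?_
  rw [forall_and, ← forall_lt_iff_le, ← forall_lt_iff_le]

theorem content_apply {lam : YoungDiagram} (T : SemistandardYoungTableau lam) (k : ℕ) :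
    content T k = (lam.cells.filter fun c => T c.1 c.2 = k).card := by
  rw [content, Finsupp.finsetSum_apply, Finset.card_filter]
  exact Finset.sum_congr rfl fun c _ => by rw [Finsupp.single_apply]

theorem content_entry_ne_zero {lam : YoungDiagram} (T : SemistandardYoungTableau lam) {i j : ℕ}
    (h : (i, j) ∈ lam) : content T (T i j) ≠ 0 := by
  rw [content_apply]
  exact Finset.card_ne_zero_of_mem (Finset.mem_filter.2 ⟨(YoungDiagram.mem_cells _).2 h, rfl⟩)

theorem degree_content {lam : YoungDiagram} (T : SemistandardYoungTableau lam) :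
    (content T).degree = lam.card := by
  rw [content, map_sum]
  simp [YoungDiagram.card]

/-- A tableau is determined by its entries on the cells, and these lie in the support of the
content. Finiteness matters because `Nat.card` of an infinite type is 0. -/
theorem finite_tableaux (lam : YoungDiagram) (d : ℕ →₀ ℕ) :
    {T : SemistandardYoungTableau lam | content T = d}.Finite := by
  refine Set.Finite.of_injOn (f := fun T (c : lam.cells) => T c.1.1 c.1.2)
    (t := Set.pi Set.univ fun _ => (d.support : Set ℕ)) ?_ ?_
    (Set.Finite.pi fun _ => Finset.finite_toSet _)
  · rintro T rfl ⟨⟨i, j⟩, hc⟩ -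
    exact Finsupp.mem_support_iff.2 (content_entry_ne_zero T ((YoungDiagram.mem_cells _).1 hc))
  · intro T _ T' _ h
    ext i j
    by_cases hc : (i, j) ∈ lam
    · exact congrFun h ⟨(i, j), (YoungDiagram.mem_cells _).2 hc⟩
    · rw [T.zeros hc, T'.zeros hc]

/-- The semistandard tableaux of shape `lam` and content `d`. -/
def tableaux (lam : YoungDiagram) (d : ℕ →₀ ℕ) : Finset (SemistandardYoungTableau lam) :=
  (finite_tableaux lam d).toFinset

@[simp]
theorem mem_tableaux {lam : YoungDiagram} {d : ℕ →₀ ℕ} {T : SemistandardYoungTableau lam} :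
    T ∈ tableaux lam d ↔ content T = d := by
  simp [tableaux]

theorem coeff_schur (K : Type*) [CommRing K] (lam : YoungDiagram) (d : ℕ →₀ ℕ) :
    (schur K lam).coeff d = ((tableaux lam d).card : K) := by
  change ((Nat.card {T | content T = d} : ℕ) : K) = _
  rw [Nat.card_coe_set_eq, Set.ncard_eq_toFinset_card _ (finite_tableaux lam d), tableaux]

/-- The shape of the part of a tableau with entries less than `n`. -/
def lowerShape {lam : YoungDiagram} (T : SemistandardYoungTableau lam) (n : ℕ) : YoungDiagram where
  cells := lam.cells.filter fun c => T c.1 c.2 < n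
  isLowerSet := by
    rintro ⟨a1, a2⟩ ⟨b1, b2⟩ hab ha
    simp only [Finset.coe_filter, Set.mem_ofPred_eq, YoungDiagram.mem_cells] at ha ⊢
    have h1 : b1 ≤ a1 := hab.1
    have h2 : b2 ≤ a2 := hab.2
    refine ⟨lam.up_left_mem h1 h2 ha.1, lt_of_le_of_lt ?_ ha.2⟩
    exact (T.row_weak_of_le h2 (lam.up_left_mem h1 le_rfl ha.1)).trans (T.col_weak h1 ha.1)

theorem mem_lowerShape {lam : YoungDiagram} {T : SemistandardYoungTableau lam} {n i j : ℕ} :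
    (i, j) ∈ lowerShape T n ↔ (i, j) ∈ lam ∧ T i j < n := by
  rw [← YoungDiagram.mem_cells, lowerShape, Finset.mem_filter, YoungDiagram.mem_cells]

/-- The restriction of a tableau to a smaller diagram. -/
def restrict {mu lam : YoungDiagram} (h : IsStrip mu lam) (T : SemistandardYoungTableau lam) :
    SemistandardYoungTableau mu where
  entry i j := open Classical in if (i, j) ∈ mu then T i j else 0
  row_weak' hj hc := by
    rw [if_pos hc, if_pos (mu.up_left_mem le_rfl hj.le hc)]
    exact T.row_weak hj ((isStrip_iff.1 h _ _).1 hc)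
  col_strict' hi hc := by
    rw [if_pos hc, if_pos (mu.up_left_mem hi.le le_rfl hc)]
    exact T.col_strict hi ((isStrip_iff.1 h _ _).1 hc)
  zeros' hc := if_neg hc

open Classical in
theorem restrict_apply {mu lam : YoungDiagram} (h : IsStrip mu lam)
    (T : SemistandardYoungTableau lam) (i j : ℕ) :
    restrict h T i j = if (i, j) ∈ mu then T i j else 0 := rfl

/-- The extension of a tableau with entries less than `n` by the entry `n` on a horizontal strip. -/
def extend {mu lam : YoungDiagram} (h : IsStrip mu lam) (S : SemistandardYoungTableau mu) (n : ℕ)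
    (hS : ∀ i j, (i, j) ∈ mu → S i j < n) : SemistandardYoungTableau lam where
  entry i j := open Classical in if (i, j) ∈ mu then S i j else if (i, j) ∈ lam then n else 0
  row_weak' {i j1 j2} hj hc := by
    by_cases h2 : (i, j2) ∈ mu
    · rw [if_pos h2, if_pos (mu.up_left_mem le_rfl hj.le h2)]
      exact S.row_weak hj h2
    · rw [if_neg h2, if_pos hc]
      split_ifs with h3
      · exact (hS _ _ h3).le
      · exact le_rfl
      · exact Nat.zero_le _
  col_strict' {i1 i2 j} hi hc := by
    obtain ⟨i, rfl⟩ : ∃ i, i2 = i + 1 := ⟨i2 - 1, by omega⟩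
    -- A column of `lam` has at most its lowest cell outside `mu`, so the upper of two cells lies in
    -- `mu`.
    have h1 : (i1, j) ∈ mu :=
      mu.up_left_mem (Nat.lt_succ_iff.1 hi) le_rfl ((isStrip_iff.1 h _ _).2 hc)
    rw [if_pos h1]
    split_ifs with h3
    · exact S.col_strict hi h3
    · exact hS _ _ h1
  zeros' {i j} hc := by
    rw [if_neg fun h' => hc ((isStrip_iff.1 h _ _).1 h'), if_neg hc]

open Classical in
theorem extend_apply {mu lam : YoungDiagram} (h : IsStrip mu lam) (S : SemistandardYoungTableau mu)
    (n : ℕ) (hS : ∀ i j, (i, j) ∈ mu → S i j < n) (i j : ℕ) :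
    extend h S n hS i j = if (i, j) ∈ mu then S i j else if (i, j) ∈ lam then n else 0 := rfl

section Branching

variable {lam : YoungDiagram} {q : ℕ →₀ ℕ} {n k : ℕ}

theorem entry_le_of_content {T : SemistandardYoungTableau lam} (hq : ∀ i, n ≤ i → q i = 0)
    (hT : content T = q + Finsupp.single n k) {i j : ℕ} (h : (i, j) ∈ lam) : T i j ≤ n := by
  by_contra hn
  refine content_entry_ne_zero T h ?_
  rw [hT, Finsupp.add_apply, hq _ (not_le.1 hn).le, Finsupp.single_apply, if_neg (by omega), add_zero]

theorem entry_lt_of_content {T : SemistandardYoungTableau lam} (hq : ∀ i, n ≤ i → q i = 0)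
    (hT : content T = q) {i j : ℕ} (h : (i, j) ∈ lam) : T i j < n := by
  by_contra hn
  exact content_entry_ne_zero T h (by rw [hT, hq _ (not_lt.1 hn)])

/-- `n` is the largest possible entry and columns are strict, so the entries `n` occupy at most the
bottom cell of each column; there are `k` of them. -/
theorem lowerShape_mem_below {T : SemistandardYoungTableau lam} (hq : ∀ i, n ≤ i → q i = 0)
    (hT : content T = q + Finsupp.single n k) : lowerShape T n ∈ below lam k := by
  rw [mem_below]
  constructor
  · have h1 : content T n = k := by
      rw [hT, Finsupp.add_apply, hq n le_rfl, zero_add, Finsupp.single_eq_same]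
    rw [content_apply] at h1
    rw [← h1, YoungDiagram.card, YoungDiagram.card, lowerShape,
      ← Finset.card_filter_add_card_filter_not (s := lam.cells) fun c => T c.1 c.2 < n]
    congr 2
    refine Finset.filter_congr fun c hc => ?_
    have := entry_le_of_content hq hT ((YoungDiagram.mem_cells _).1 hc : (c.1, c.2) ∈ lam)
    omega
  · rw [isStrip_iff]
    refine fun i j => ⟨fun h => (mem_lowerShape.1 h).1, fun h => mem_lowerShape.2
      ⟨lam.up_left_mem (Nat.le_succ i) le_rfl h, ?_⟩⟩
    exact (T.col_strict (Nat.lt_succ_self i) h).trans_le (entry_le_of_content hq hT h)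

theorem content_eq_of_restrict {mu : YoungDiagram} {T : SemistandardYoungTableau lam}
    {S : SemistandardYoungTableau mu} (h : IsStrip mu lam) (hc : lam.card = mu.card + k)
    (h1 : ∀ i j, (i, j) ∈ mu → T i j = S i j) (h2 : ∀ i j, (i, j) ∈ lam → (i, j) ∉ mu → T i j = n) :
    content T = content S + Finsupp.single n k := by
  rw [content, content, ← Finset.sum_sdiff h.cells_subset, add_comm]
  congr 1
  · refine Finset.sum_congr rfl fun c hc => ?_
    rw [h1 _ _ ((YoungDiagram.mem_cells _).1 hc)]
  · rw [Finset.sum_congr rfl (g := fun _ => Finsupp.single n 1), Finset.sum_const,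
      Finset.card_sdiff_of_subset h.cells_subset, Finsupp.smul_single, smul_eq_mul, mul_one]
    · congr 1
      change lam.card - mu.card = k
      omega
    · intro c hc
      rw [Finset.mem_sdiff, YoungDiagram.mem_cells, YoungDiagram.mem_cells] at hc
      rw [h2 _ _ hc.1 hc.2]

/-- Sort the tableaux by the shape of the entries below `n`. On each fibre, erasing the entries `n`
and filling the strip with `n` again are inverse to each other. -/
theorem card_tableaux_add_single (hq : ∀ i, n ≤ i → q i = 0) :
    (tableaux lam (q + Finsupp.single n k)).card = ∑ mu ∈ below lam k, (tableaux mu q).card := by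
  classical
  rw [Finset.card_eq_sum_card_fiberwise (f := fun T => lowerShape T n) (t := below lam k)
    fun T hT => lowerShape_mem_below hq (mem_tableaux.1 hT)]
  refine Finset.sum_congr rfl fun mu hmu => ?_
  obtain ⟨hc, hs⟩ := mem_below.1 hmu
  refine Finset.card_bij' (fun T _ => restrict hs T)
    (fun S hS => extend hs S n fun i j h => entry_lt_of_content hq (mem_tableaux.1 hS) h) ?_ ?_ ?_ ?_
  · intro T hT
    rw [Finset.mem_filter, mem_tableaux] at hT
    obtain ⟨hT, rfl⟩ := hT
    have := content_eq_of_restrict (n := n) (T := T) (S := restrict hs T) hs hc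
      (fun i j h => by rw [restrict_apply, if_pos h])
      (fun i j h h' => by
        have h1 := entry_le_of_content hq hT h
        have h2 : ¬ T i j < n := fun h2 => h' (mem_lowerShape.2 ⟨h, h2⟩)
        omega)
    rw [hT] at this
    exact mem_tableaux.2 (add_right_cancel this).symm
  · intro S hS
    have hS' := mem_tableaux.1 hS
    rw [Finset.mem_filter, mem_tableaux]
    constructor
    · refine (content_eq_of_restrict (S := S) hs hc (fun i j h => ?_) fun i j h h' => ?_).trans
        (by rw [hS'])
      · rw [extend_apply, if_pos h]
      · rw [extend_apply, if_neg h', if_pos h]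
    · ext ⟨i, j⟩
      rw [YoungDiagram.mem_cells, YoungDiagram.mem_cells, mem_lowerShape, extend_apply]
      by_cases h : (i, j) ∈ mu
      · simp [h, (isStrip_iff.1 hs _ _).1 h, entry_lt_of_content hq hS' h]
      · by_cases h' : (i, j) ∈ lam <;> simp [h, h']
  · intro T hT
    obtain ⟨hT', rfl⟩ := Finset.mem_filter.1 hT
    rw [mem_tableaux] at hT'
    ext i j
    rw [extend_apply, restrict_apply]
    by_cases h' : (i, j) ∈ lam
    · have h1 := entry_le_of_content hq hT' h'
      by_cases h : (i, j) ∈ lowerShape T n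
      · rw [if_pos h, if_pos h]
      · have h2 : ¬ T i j < n := fun h2 => h (mem_lowerShape.2 ⟨h', h2⟩)
        rw [if_neg h, if_pos h']
        omega
    · rw [if_neg fun h => h' (mem_lowerShape.1 h).1, if_neg h', T.zeros h']
  · intro S hS
    ext i j
    rw [restrict_apply, extend_apply]
    by_cases h : (i, j) ∈ mu
    · rw [if_pos h, if_pos h]
    · rw [if_neg h, S.zeros h]

theorem coeff_schur_add_single (K : Type*) [CommRing K] (lam : YoungDiagram) (k : ℕ)
    (hq : ∀ i, n ≤ i → q i = 0) : (schur K lam).coeff (q + Finsupp.single n k) =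
      ∑ mu ∈ below lam k, (schur K mu).coeff q := by
  simp only [coeff_schur, card_tableaux_add_single hq, Nat.cast_sum]

theorem coeff_schur_of_degree_ne (K : Type*) [CommRing K] {lam : YoungDiagram} {d : ℕ →₀ ℕ}
    (h : d.degree ≠ lam.card) : (schur K lam).coeff d = 0 := by
  rw [coeff_schur, Finset.card_eq_zero.2, Nat.cast_zero]
  refine Finset.eq_empty_of_forall_notMem fun T hT => h ?_
  rw [← mem_tableaux.1 hT, degree_content]

end Branching

/-! ### Complete homogeneous symmetric functions and the Pieri rule -/

section Complete

variable {K : Type*} [CommRing K]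

/-- The Cauchy product with the exponent of the variable `n` split off, so that branching in this
variable can be applied to each factor. -/
theorem coeff_add_single_mul (F G : MvPowerSeries ℕ K) {e : ℕ →₀ ℕ} {n : ℕ} (he : e n = 0) (b : ℕ) :
    (F * G).coeff (e + Finsupp.single n b) =
      ∑ ij ∈ Finset.HasAntidiagonal.antidiagonal b, ∑ pq ∈ Finset.HasAntidiagonal.antidiagonal e,
        F.coeff (pq.1 + Finsupp.single n ij.1) * G.coeff (pq.2 + Finsupp.single n ij.2) := by
  classical
  rw [MvPowerSeries.coeff_mul, ← Finset.sum_product']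
  refine Finset.sum_bij' (fun r _ => ((r.1 n, r.2 n), (r.1.erase n, r.2.erase n)))
    (fun s _ => (s.2.1 + Finsupp.single n s.1.1, s.2.2 + Finsupp.single n s.1.2)) ?_ ?_ ?_ ?_ ?_
  · rintro ⟨p, q⟩ h
    rw [Finset.HasAntidiagonal.mem_antidiagonal] at h
    simp only [Finset.mem_product, Finset.HasAntidiagonal.mem_antidiagonal]
    constructor
    · have := DFunLike.congr_fun h n
      simpa [he] using this
    · rw [← Finsupp.erase_add, h, Finsupp.erase_add, Finsupp.erase_single, add_zero,
        Finsupp.erase_of_notMem_support (by simpa using he)]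
  · rintro ⟨⟨i, j⟩, p, q⟩ h
    simp only [Finset.mem_product, Finset.HasAntidiagonal.mem_antidiagonal] at h ⊢
    rw [← h.1, ← h.2, Finsupp.single_add]
    abel
  · rintro ⟨p, q⟩ _
    simp only [Finsupp.erase_add_single]
  · rintro ⟨⟨i, j⟩, p, q⟩ h
    simp only [Finset.mem_product, Finset.HasAntidiagonal.mem_antidiagonal] at h
    have h1 : p n + q n = 0 := by rw [← he, ← h.2, Finsupp.add_apply]
    have hp : p n = 0 := by omega
    have hq : q n = 0 := by omega
    simp [hp, hq, Finsupp.erase_add, Finsupp.erase_of_notMem_support]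
  · rintro ⟨p, q⟩ _
    simp only [Finsupp.erase_add_single]

/-- The complete homogeneous symmetric function `h_n`, the sum of all monomials of degree `n`. -/
def complete (K : Type*) [CommRing K] (n : ℕ) : SymFun K :=
  ⟨fun d => if d.degree = n then 1 else 0, by
    set F : MvPowerSeries ℕ K := fun d => if d.degree = n then 1 else 0
    refine ⟨fun σ => ?_, n, fun d hd => if_neg (by omega)⟩
    ext d
    obtain ⟨d, rfl⟩ : ∃ d', Finsupp.mapDomain σ d' = d :=
      ⟨d.mapDomain σ.symm, by rw [← Finsupp.mapDomain_comp, Equiv.self_comp_symm, Finsupp.mapDomain_id]⟩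
    rw [coeff_rename_equiv]
    change (if _ then (1 : K) else 0) = if _ then 1 else 0
    rw [Finsupp.degree_mapDomain]⟩

theorem coeff_complete (n : ℕ) (d : ℕ →₀ ℕ) :
    (complete K n : MvPowerSeries ℕ K).coeff d = if d.degree = n then 1 else 0 := rfl

theorem complete_zero : complete K 0 = 1 := by
  classical
  apply Subtype.ext
  ext d
  rw [coeff_complete, OneMemClass.coe_one, MvPowerSeries.coeff_one]
  simp [Finsupp.degree_eq_zero_iff]

theorem coeff_complete_add_single (a i : ℕ) (p : ℕ →₀ ℕ) (n : ℕ) :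
    (complete K a : MvPowerSeries ℕ K).coeff (p + Finsupp.single n i) =
      if i ≤ a then (complete K (a - i) : MvPowerSeries ℕ K).coeff p else 0 := by
  rw [coeff_complete, coeff_complete, map_add, Finsupp.degree_single, ← ite_and]
  refine if_congr ?_ rfl rfl
  omega

theorem card_eq_zero_iff {lam : YoungDiagram} : lam.card = 0 ↔ lam = ⊥ := by
  rw [YoungDiagram.card, Finset.card_eq_zero]
  constructor
  · intro h
    ext c
    simp [h]
  · rintro rfl
    rfl

theorem rowLen_bot (i : ℕ) : (⊥ : YoungDiagram).rowLen i = 0 := by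
  by_contra h
  exact YoungDiagram.notMem_bot _ (YoungDiagram.mem_iff_lt_rowLen.2 (Nat.pos_of_ne_zero h))

theorem schur_bot : schur K ⊥ = 1 := by
  classical
  ext d
  rw [MvPowerSeries.coeff_one]
  split_ifs with h
  · subst h
    have := kostka_diag K (n := 0) ⟨⊥, rfl⟩
    change (schur K ⊥).coeff (expo ⊥) = 1 at this
    rwa [show expo ⊥ = 0 from Finsupp.ext rowLen_bot] at this
  · refine coeff_schur_of_degree_ne K ?_
    rw [card_eq_zero_iff.2 rfl]
    rwa [Ne, Finsupp.degree_eq_zero_iff]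

/-- The Pieri rule. -/
theorem complete_mul_schur (lam : YoungDiagram) (a : ℕ) :
    (complete K a : MvPowerSeries ℕ K) * schur K lam = ∑ nu ∈ above lam a, schur K nu := by
  ext e
  rw [map_sum]
  induction e using Finsupp.induction_on_max generalizing lam a with
  | zero =>
    rw [MvPowerSeries.coeff_zero_eq_constantCoeff_apply, map_mul,
      ← MvPowerSeries.coeff_zero_eq_constantCoeff_apply,
      ← MvPowerSeries.coeff_zero_eq_constantCoeff_apply, coeff_complete, map_zero]
    by_cases h : 0 = a ∧ lam = ⊥
    · obtain ⟨rfl, rfl⟩ := h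
      rw [if_pos rfl, one_mul, Finset.sum_eq_single ⊥]
      · intro nu hnu hne
        refine absurd (card_eq_zero_iff.1 ?_) hne
        rw [(mem_above.1 hnu).1]
        rfl
      · intro h
        refine absurd (mem_above.2 ⟨rfl, fun i => ?_⟩) h
        simp [rowLen_bot]
    · rw [Finset.sum_eq_zero]
      · split_ifs with h0
        · rw [coeff_schur_of_degree_ne, mul_zero]
          rw [map_zero]
          exact fun h' => h ⟨h0, card_eq_zero_iff.1 h'.symm⟩
        · rw [zero_mul]
      · intro nu hnu
        refine coeff_schur_of_degree_ne K ?_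
        rw [(mem_above.1 hnu).1, map_zero]
        intro h'
        exact h ⟨by omega, card_eq_zero_iff.1 (by omega)⟩
  | single_add n b e hn _ ih =>
    have hq : ∀ i, n ≤ i → e i = 0 := fun i hi => by
      by_contra h
      have := hn i (Finsupp.mem_support_iff.2 h)
      omega
    rw [add_comm, coeff_add_single_mul _ _ (hq n le_rfl)]
    simp only [coeff_schur_add_single K _ _ hq]
    -- Both sides are now branched in the largest variable. The summation index k of
    -- `sum_above_below` is the exponent that h_a contributes; s_λ contributes b - k. Exponents
    -- exceeding a give zero terms, and for the others the induction hypothesis applies to h_{a-k}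
    -- s_κ.
    rw [sum_above_below, Finset.Nat.sum_antidiagonal_eq_sum_range_succ_mk]
    symm
    refine Finset.sum_subset_zero_on_sdiff (fun i hi => ?_) (fun i hi => ?_) (fun i hi => ?_)
    · simp only [Finset.mem_range] at hi ⊢
      omega
    · simp only [Finset.mem_sdiff, Finset.mem_range] at hi
      refine Finset.sum_eq_zero fun pq _ => ?_
      rw [coeff_complete_add_single, if_neg (by omega), zero_mul]
    · simp only [Finset.mem_range] at hi
      rw [Finset.sum_congr rfl fun kap _ => (ih kap (a - i)).symm]
      simp only [MvPowerSeries.coeff_mul]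
      rw [Finset.sum_comm]
      refine Finset.sum_congr rfl fun pq hpq => ?_
      have hpq' : ∀ i, n ≤ i → pq.2 i = 0 := fun i hi => by
        have h1 := hq i hi
        rw [← Finset.HasAntidiagonal.mem_antidiagonal.1 hpq, Finsupp.add_apply] at h1
        omega
      rw [coeff_complete_add_single, if_pos (by omega), coeff_schur_add_single K _ _ hpq',
        Finset.mul_sum]

/-- The product of the complete homogeneous symmetric functions `h_{d i}`. -/
def completeProd (K : Type*) [CommRing K] (d : ℕ →₀ ℕ) : SymFun K := d.prod fun _ n => complete K n

theorem completeProd_zero : completeProd K 0 = 1 := Finsupp.prod_zero_index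

theorem completeProd_single (i n : ℕ) :
    completeProd K (Finsupp.single i n) = complete K n := by
  unfold completeProd
  exact Finsupp.prod_single_index (h := fun _ n => complete K n) complete_zero

theorem completeProd_mapDomain {f : ℕ → ℕ} (hf : Function.Injective f) (d : ℕ →₀ ℕ) :
    completeProd K (d.mapDomain f) = completeProd K d :=
  Finsupp.prod_mapDomain_index_inj hf

theorem completeProd_add {d e : ℕ →₀ ℕ} (h : Disjoint d.support e.support) :
    completeProd K (d + e) = completeProd K d * completeProd K e :=
  Finsupp.prod_add_index_of_disjoint h _

/-- Splitting off the last variable of `d` multiplies by one more h_b, which adds a horizontal strip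
by Pieri; branching removes the same strip from the coefficient of x^d in s_λ. Working with
arbitrary exponent vectors, not only partitions, avoids any appeal to the symmetry of Schur
functions. -/
theorem completeProd_eq_sum (d : ℕ →₀ ℕ) : (completeProd K d : MvPowerSeries ℕ K) =
    ∑ lam ∈ diagrams d.degree, (schur K lam).coeff d • schur K lam := by
  induction d using Finsupp.induction_on_max with
  | zero =>
    rw [completeProd_zero, OneMemClass.coe_one, map_zero, Finset.sum_eq_single ⊥, schur_bot]
    · simp
    · intro lam h h'
      exact absurd (card_eq_zero_iff.1 (mem_diagrams.1 h)) h'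
    · intro h
      exact absurd (mem_diagrams.2 rfl) h
  | single_add n b e hn _ ih =>
    have hq : ∀ i, n ≤ i → e i = 0 := fun i hi => by
      by_contra h
      have := hn i (Finsupp.mem_support_iff.2 h)
      omega
    have hprod : completeProd K (Finsupp.single n b + e) = complete K b * completeProd K e := by
      rw [completeProd_add]
      · rw [completeProd_single]
      · refine Finset.disjoint_left.2 fun i hi hi' => ?_
        have h1 := hn i hi'
        rw [Finset.mem_singleton.1 (Finsupp.support_single_subset hi)] at h1
        exact lt_irrefl _ h1
    rw [hprod, MulMemClass.coe_mul, ih, Finset.mul_sum]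
    simp only [mul_smul_comm, complete_mul_schur, Finset.smul_sum]
    rw [add_comm (Finsupp.single n b)]
    simp only [coeff_schur_add_single K _ _ hq, Finset.sum_smul]
    refine Finset.sum_comm' fun lam mu => ?_
    rw [mem_below_iff_mem_above, mem_diagrams, mem_diagrams, map_add, Finsupp.degree_single, mem_above]
    constructor
    · rintro ⟨h1, h2, h3⟩
      exact ⟨⟨h2, h3⟩, by omega⟩
    · rintro ⟨⟨h2, h3⟩, h1⟩
      exact ⟨by omega, h2, h3⟩

theorem schurCoeff_completeProd (d : ℕ →₀ ℕ) (n : ℕ) (lam : Part n) :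
    schurCoeff K n (completeProd K d : MvPowerSeries ℕ K) lam = (schur K lam.1).coeff d := by
  classical
  rw [completeProd_eq_sum, map_sum, Finset.sum_apply]
  simp only [map_smul, Pi.smul_apply, schurCoeff_schur, smul_eq_mul, mul_ite, mul_one, mul_zero]
  rw [Finset.sum_ite_eq']
  split_ifs with h
  · rfl
  · rw [coeff_schur_of_degree_ne]
    exact fun h' => h (mem_diagrams.2 h'.symm)

end Complete

/-! ### Duality of complete and monomial symmetric functions -/

/-- Sort the support by decreasing exponent (hence `ℕᵒᵈ`) and move it onto an initial segment of ℕ,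
which is possible as `Equiv.Perm ℕ` is multiply transitive. -/
theorem exists_perm_antitone (d : ℕ →₀ ℕ) :
    ∃ σ : Equiv.Perm ℕ, Antitone (d.mapDomain σ : ℕ → ℕ) := by
  let c := d.support.equivFin.symm
  let g : Fin d.support.card → ℕᵒᵈ := fun i => OrderDual.toDual (d (c i))
  let a : Fin d.support.card ↪ ℕ :=
    ((Tuple.sort g).trans c).toEmbedding.trans (Function.Embedding.subtype _)
  have ha : ∀ i j, i ≤ j → d (a j) ≤ d (a i) := fun i j h => Tuple.monotone_sort g h
  have := Equiv.Perm.isMultiplyPretransitive ℕ d.support.card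
  obtain ⟨σ, hσ⟩ := MulAction.exists_smul_eq (Equiv.Perm ℕ) a Fin.valEmbedding
  have hσ' : ∀ i, σ (a i) = i := fun i => DFunLike.congr_fun hσ i
  have hd : ∀ k, d.mapDomain σ k = d (σ.symm k) := fun k => by
    conv_lhs => rw [← σ.apply_symm_apply k]
    exact Finsupp.mapDomain_apply σ.injective _ _
  refine ⟨σ, fun k l hkl => ?_⟩
  rw [hd, hd]
  by_cases hl : l < d.support.card
  · have hk := hkl.trans_lt hl
    have e1 : σ.symm l = a ⟨l, hl⟩ := by rw [Equiv.symm_apply_eq, hσ']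
    have e2 : σ.symm k = a ⟨k, hk⟩ := by rw [Equiv.symm_apply_eq, hσ']
    rw [e1, e2]
    exact ha _ _ hkl
  · refine le_of_eq_of_le ?_ (Nat.zero_le _)
    by_contra h
    let s : d.support := ⟨σ.symm l, Finsupp.mem_support_iff.2 h⟩
    obtain ⟨i, hi⟩ : ∃ i, a i = σ.symm l := by
      refine ⟨((Tuple.sort g).trans c).symm s, ?_⟩
      change (((Tuple.sort g).trans c) (((Tuple.sort g).trans c).symm s) : ℕ) = _
      rw [Equiv.apply_symm_apply]
    have := hσ' i
    rw [hi, Equiv.apply_symm_apply] at this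
    exact hl (this ▸ i.2)

theorem exists_perm_expo (d : ℕ →₀ ℕ) :
    ∃ (σ : Equiv.Perm ℕ) (lam : YoungDiagram), d.mapDomain σ = expo lam := by
  obtain ⟨σ, hσ⟩ := exists_perm_antitone d
  obtain ⟨N, hN⟩ := (d.mapDomain σ).support.exists_nat_subset_range
  obtain ⟨lam, h⟩ := exists_rowLen_eq hσ (N := N) (by
    by_contra h
    exact Finset.notMem_range_self (hN (Finsupp.mem_support_iff.2 h)))
  exact ⟨σ, lam, Finsupp.ext fun i => (congrFun h i).symm⟩

section Duality

variable {K : Type*} [CommRing K]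

theorem eq_of_coeff_expo {F G : MvPowerSeries ℕ K} (hF : F ∈ SymSeries K) (hG : G ∈ SymSeries K)
    (h : ∀ lam : YoungDiagram, F.coeff (expo lam) = G.coeff (expo lam)) : F = G := by
  ext d
  obtain ⟨σ, lam, hd⟩ := exists_perm_expo d
  rw [← coeff_perm hF σ, ← coeff_perm hG σ, hd, h]

theorem eq_of_schurCoeff {F G : MvPowerSeries ℕ K} (hF : F ∈ SymSeries K) (hG : G ∈ SymSeries K)
    (h : ∀ n, schurCoeff K n F = schurCoeff K n G) : F = G := by
  refine eq_of_coeff_expo hF hG fun lam => ?_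
  have h1 := schurCoeff_spec K F (⟨lam, rfl⟩ : Part lam.card)
  have h2 := schurCoeff_spec K G (⟨lam, rfl⟩ : Part lam.card)
  rw [h] at h1
  exact h1.trans h2.symm

theorem hall_apply (F : SymSeries K) (f : SymFun K) :
    hall F f = ∑ᶠ n : ℕ, ∑ lam : Part n, schurCoeff K n F.1 lam * schurCoeff K n f.1 lam := rfl

/-- The complete and the monomial symmetric functions are dual bases for the Hall inner product. -/
theorem hall_completeProd (F : SymSeries K) (d : ℕ →₀ ℕ) :
    hall F (completeProd K d) = F.1.coeff d := by
  obtain ⟨σ, mu, hd⟩ := exists_perm_expo d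
  -- Sorting `d` into a partition changes neither side, and at a partition the claim is the linear
  -- system that defines `schurCoeff`.
  rw [← completeProd_mapDomain σ.injective, ← coeff_perm F.2 σ, hd, hall_apply]
  simp only [schurCoeff_completeProd]
  rw [finsum_eq_single _ mu.card]
  · exact (schurCoeff_spec K F.1 (⟨mu, rfl⟩ : Part mu.card)).symm
  · intro n hn
    refine Finset.sum_eq_zero fun lam _ => ?_
    rw [coeff_schur_of_card_ne, mul_zero]
    rw [lam.2]
    exact hn

theorem hall_one (F : SymSeries K) : hall F 1 = MvPowerSeries.constantCoeff F.1 := by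
  rw [← completeProd_zero, hall_completeProd, MvPowerSeries.coeff_zero_eq_constantCoeff_apply]

/-- In each degree the transition matrix from Schur to complete functions is `kostka`, which has
determinant 1 and so is invertible over any `K`. -/
theorem span_completeProd : Submodule.span K (Set.range (completeProd K)) = ⊤ := by
  refine eq_top_iff.2 ?_
  rintro f -
  obtain ⟨hf, N, hN⟩ := f.2
  let c : ∀ n, Part n → K := fun n => Matrix.mulVec (kostka K n)⁻¹ (schurCoeff K n f.1)
  have h : f = ∑ n ∈ Finset.range (N + 1), ∑ mu : Part n, c n mu • completeProd K (expo mu.1) := by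
    apply Subtype.ext
    refine eq_of_schurCoeff hf (SetLike.coe_mem (p := SymFun K) _).1 fun n => ?_
    funext lam
    simp only [AddSubmonoidClass.coe_finsetSum, Subalgebra.coe_smul, map_sum, map_smul,
      Finset.sum_apply, Pi.smul_apply, schurCoeff_completeProd, smul_eq_mul]
    rw [Finset.sum_eq_single n]
    · have : Matrix.mulVec (kostka K n) (c n) = schurCoeff K n f.1 := by
        rw [Matrix.mulVec_mulVec, Matrix.mul_nonsing_inv _ (by rw [kostka_det]; exact isUnit_one),
          Matrix.one_mulVec]
      rw [← this, Matrix.mulVec, dotProduct]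
      exact Finset.sum_congr rfl fun mu _ => mul_comm _ _
    · intro m _ hm
      refine Finset.sum_eq_zero fun mu _ => ?_
      rw [coeff_schur_of_card_ne, mul_zero]
      rw [lam.2, mu.2]
      exact hm.symm
    · intro hn
      have h0 : c n = 0 := by
        have : schurCoeff K n f.1 = 0 := by
          refine schurCoeff_unique K _ _ fun mu => ?_
          rw [hN _ (by rw [degree_expo, mu.2]; simpa using hn)]
          simp
        simp only [c, this, Matrix.mulVec_zero]
      simp [h0]
  rw [h]
  exact Submodule.sum_mem _ fun n _ => Submodule.sum_mem _ fun mu _ =>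
    Submodule.smul_mem _ _ (Submodule.subset_span ⟨_, rfl⟩)

/-! ### Group-like series -/

theorem coeff_inXY (F : MvPowerSeries ℕ K) (u : ℕ ⊕ ℕ →₀ ℕ) :
    (inXY F).coeff u = F.coeff (u.mapDomain Equiv.natSumNatEquivNat) := by
  have hu := Finsupp.mapDomain_comp (v := u) (f := Equiv.natSumNatEquivNat)
    (g := Equiv.natSumNatEquivNat.symm)
  rw [Equiv.symm_comp_self, Finsupp.mapDomain_id] at hu
  conv_lhs => rw [hu]
  exact coeff_rename_equiv _ _ _

/-- The vector `u` carries `d` and `e` on the disjoint sets of indices used for x and y, so the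
product of complete functions splits. -/
theorem exists_coeff_inXY (d e : ℕ →₀ ℕ) : ∃ u : ℕ →₀ ℕ,
    (∀ F : MvPowerSeries ℕ K, (inXY F).coeff (d.sumElim e) = F.coeff u) ∧
      completeProd K u = completeProd K d * completeProd K e := by
  refine ⟨(d.sumElim e).mapDomain Equiv.natSumNatEquivNat, fun F => coeff_inXY F _, ?_⟩
  · rw [Finsupp.sumElim_eq_add, Finsupp.mapDomain_add, ← Finsupp.mapDomain_comp,
      ← Finsupp.mapDomain_comp, completeProd_add, completeProd_mapDomain, completeProd_mapDomain]
    · exact Equiv.natSumNatEquivNat.injective.comp Sum.inr_injective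
    · exact Equiv.natSumNatEquivNat.injective.comp Sum.inl_injective
    · refine Finset.disjoint_left.2 fun i hi hi' => ?_
      obtain ⟨x, _, rfl⟩ := Finset.mem_image.1 (Finsupp.mapDomain_support hi)
      obtain ⟨y, _, hy⟩ := Finset.mem_image.1 (Finsupp.mapDomain_support hi')
      exact Sum.inr_ne_inl (Equiv.natSumNatEquivNat.injective hy)

theorem exists_sumElim (u : ℕ ⊕ ℕ →₀ ℕ) : ∃ d e : ℕ →₀ ℕ, d.sumElim e = u := by
  refine ⟨u.comapDomain Sum.inl Sum.inl_injective.injOn,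
    u.comapDomain Sum.inr Sum.inr_injective.injOn, ?_⟩
  ext (i | i) <;> rfl

/-- By duality both conditions say (F, h_d h_e) = (F, h_d)(F, h_e) for all d, e; bilinearity and
spanning extend this to all of Λ. -/
theorem inXY_eq_mul_iff (F : SymSeries K) : inXY F.1 = inX F.1 * inY F.1 ↔
    ∀ f g, hall F (f * g) = hall F f * hall F g := by
  constructor
  · intro h
    have h1 : (LinearMap.mul K (SymFun K)).compr₂ (hall F) =
        (LinearMap.mul K K).compl₁₂ (hall F) (hall F) := by
      refine LinearMap.ext_on_range (v := completeProd K) span_completeProd fun d =>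
        LinearMap.ext_on_range (v := completeProd K) span_completeProd fun e => ?_
      obtain ⟨u, hu, hu'⟩ := exists_coeff_inXY (K := K) d e
      simp only [LinearMap.compr₂_apply, LinearMap.compl₁₂_apply, LinearMap.mul_apply']
      rw [← hu', hall_completeProd, hall_completeProd, hall_completeProd, ← hu, h,
        coeff_inX_mul_inY]
    exact fun f g => LinearMap.congr_fun (LinearMap.congr_fun h1 f) g
  · intro h
    ext v
    obtain ⟨d, e, rfl⟩ := exists_sumElim v
    obtain ⟨u, hu, hu'⟩ := exists_coeff_inXY (K := K) d e
    rw [hu, coeff_inX_mul_inY, ← hall_completeProd, ← hall_completeProd, ← hall_completeProd, hu', h]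

/-! ### The map F^⊥: coefficients, triangularity and bijectivity -/

/-- The linear functional extracting a coefficient of a symmetric function. -/
def coeffFun (K : Type*) [CommRing K] (e : ℕ →₀ ℕ) : SymFun K →ₗ[K] K :=
  MvPowerSeries.coeff e ∘ₗ (SymFun K).val.toLinearMap

theorem coeffFun_apply (e : ℕ →₀ ℕ) (f : SymFun K) : coeffFun K e f = f.1.coeff e := rfl

/-- The coefficient of `y^e` in `f(x, y)`. -/
def coeffY (f : SymFun K) (e : ℕ →₀ ℕ) : SymFun K :=
  TensorProduct.rid K (SymFun K) ((coeffFun K e).lTensor (SymFun K) (coproduct K f))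

theorem coeff_coeffY (f : SymFun K) (e d : ℕ →₀ ℕ) :
    (coeffY f e : MvPowerSeries ℕ K).coeff d = (inXY f.1).coeff (d.sumElim e) := by
  rw [← tensorToXY_coproduct, coeffY]
  induction coproduct K f with
  | zero => simp
  | add s t hs ht => simp only [map_add, AddMemClass.coe_add, hs, ht]
  | tmul g h =>
    rw [tensorToXY_tmul, coeff_inX_mul_inY, LinearMap.lTensor_tmul, TensorProduct.rid_tmul,
      Subalgebra.coe_smul, map_smul, smul_eq_mul, mul_comm, coeffFun_apply]

/-- Pairing with `F` and extracting a coefficient act on different tensor factors of Δ f, so their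
order may be exchanged. -/
theorem coeff_perp (F : SymSeries K) (f : SymFun K) (e : ℕ →₀ ℕ) :
    (perp F f : MvPowerSeries ℕ K).coeff e = hall F (coeffY f e) := by
  rw [coeffY, perp]
  simp only [LinearMap.comp_apply, AlgHom.toLinearMap_apply, LinearEquiv.coe_coe]
  induction coproduct K f with
  | zero => simp
  | add s t hs ht => simp only [map_add, AddMemClass.coe_add, hs, ht]
  | tmul g h =>
    rw [LinearMap.lTensor_tmul, TensorProduct.rid_tmul, LinearMap.rTensor_tmul,
      TensorProduct.lid_tmul, Subalgebra.coe_smul, map_smul, map_smul, smul_eq_mul, smul_eq_mul,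
      mul_comm, coeffFun_apply]

/-- The injection `g` need not be a permutation, so invariance does not apply directly; but by
duality the coefficient is a pairing with a product that depends only on the nonzero exponents. -/
theorem coeff_mapDomain {F : MvPowerSeries ℕ K} (hF : F ∈ SymSeries K) {g : ℕ → ℕ}
    (hg : Function.Injective g) (d : ℕ →₀ ℕ) : F.coeff (d.mapDomain g) = F.coeff d := by
  rw [← hall_completeProd ⟨F, hF⟩, completeProd_mapDomain hg, hall_completeProd]

theorem coeffY_zero (f : SymFun K) : coeffY f 0 = f := by
  apply Subtype.ext
  ext d
  rw [coeff_coeffY, coeff_inXY, Finsupp.sumElim_eq_add, Finsupp.mapDomain_zero, add_zero,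
    ← Finsupp.mapDomain_comp]
  exact coeff_mapDomain f.2.1 (Equiv.natSumNatEquivNat.injective.comp Sum.inl_injective) d

theorem coeff_zero_coeffY (f : SymFun K) (e : ℕ →₀ ℕ) :
    (coeffY f e : MvPowerSeries ℕ K).coeff 0 = f.1.coeff e := by
  rw [coeff_coeffY, coeff_inXY, Finsupp.sumElim_eq_add, Finsupp.mapDomain_zero, zero_add,
    ← Finsupp.mapDomain_comp]
  exact coeff_mapDomain f.2.1 (Equiv.natSumNatEquivNat.injective.comp Sum.inr_injective) e

theorem constantCoeff_perp (F : SymSeries K) (f : SymFun K) :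
    MvPowerSeries.constantCoeff (perp F f : MvPowerSeries ℕ K) = hall F f := by
  rw [← MvPowerSeries.coeff_zero_eq_constantCoeff_apply, coeff_perp, coeffY_zero]

/-- If `F(0) = 1`, then `F^⊥` is the identity up to terms of lower degree. -/
theorem coeff_perp_sub_self {F : SymSeries K} (hF : MvPowerSeries.constantCoeff F.1 = 1)
    {f : SymFun K} {N : ℕ} (hf : ∀ d : ℕ →₀ ℕ, N + 1 ≤ d.degree → f.1.coeff d = 0)
    (e : ℕ →₀ ℕ) (he : N ≤ e.degree) :
    (perp F f - f : SymFun K).1.coeff e = 0 := by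
  classical
  -- For d ≠ 0 the monomial x^d y^e has degree at least N + 1, so only the constant term of the
  -- coefficient of y^e survives.
  have h : coeffY f e = f.1.coeff e • (1 : SymFun K) := by
    apply Subtype.ext
    ext d
    rw [Subalgebra.coe_smul, map_smul, OneMemClass.coe_one, MvPowerSeries.coeff_one, smul_eq_mul]
    split_ifs with hd
    · rw [hd, coeff_zero_coeffY, mul_one]
    · rw [coeff_coeffY, coeff_inXY, mul_zero]
      refine hf _ ?_
      rw [Finsupp.degree_mapDomain, Finsupp.sumElim_eq_add, map_add, Finsupp.degree_mapDomain,
        Finsupp.degree_mapDomain]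
      have : d.degree ≠ 0 := fun h => hd ((Finsupp.degree_eq_zero_iff d).1 h)
      omega
  rw [AddSubgroupClass.coe_sub, map_sub, coeff_perp, h, map_smul, hall_one, hF, smul_eq_mul,
    mul_one, sub_self]

/-- F^⊥ is unitriangular for the degree filtration. If F^⊥ f = 0, then f is minus F^⊥ f - f and so
has smaller degree; and f = F^⊥ f - (F^⊥ f - f) reduces surjectivity to smaller degree. -/
theorem perp_bijective {F : SymSeries K} (hF : MvPowerSeries.constantCoeff F.1 = 1) :
    Function.Bijective (perp F) := by
  constructor
  · rw [injective_iff_map_eq_zero]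
    -- The degree bound is strict, so that the base case N = 0 is f = 0.
    have key : ∀ (N : ℕ) (f : SymFun K), (∀ d : ℕ →₀ ℕ, N ≤ d.degree → f.1.coeff d = 0) →
        perp F f = 0 → f = 0 := by
      intro N
      induction N with
      | zero => exact fun f hf _ => Subtype.ext (MvPowerSeries.ext fun d => hf d (Nat.zero_le _))
      | succ N ih =>
        intro f hf h
        refine ih f (fun d hd => ?_) h
        have := coeff_perp_sub_self hF hf d hd
        rwa [h, zero_sub, NegMemClass.coe_neg, map_neg, neg_eq_zero] at this
    intro f h
    obtain ⟨N, hN⟩ := f.2.2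
    exact key (N + 1) f hN h
  · have key : ∀ (N : ℕ) (f : SymFun K), (∀ d : ℕ →₀ ℕ, N ≤ d.degree → f.1.coeff d = 0) →
        ∃ g, perp F g = f := by
      intro N
      induction N with
      | zero =>
        refine fun f hf => ⟨0, ?_⟩
        rw [map_zero]
        exact Subtype.ext (MvPowerSeries.ext fun d => (hf d (Nat.zero_le _)).symm)
      | succ N ih =>
        intro f hf
        obtain ⟨g, hg⟩ := ih _ (coeff_perp_sub_self hF hf)
        exact ⟨f - g, by rw [map_sub, hg, sub_sub_cancel]⟩
    intro f
    obtain ⟨N, hN⟩ := f.2.2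
    exact key (N + 1) f hN

/-- `F^⊥` as an algebra homomorphism, when `(F, -)` is one. -/
def perpAlgHom (φ : SymFun K →ₐ[K] K) : SymFun K →ₐ[K] SymFun K :=
  ((Algebra.TensorProduct.lid K (SymFun K)).toAlgHom.comp
    (Algebra.TensorProduct.map φ (AlgHom.id K (SymFun K)))).comp (coproduct K)

theorem perpAlgHom_apply {F : SymSeries K} {φ : SymFun K →ₐ[K] K} (hφ : φ.toLinearMap = hall F)
    (f : SymFun K) : perpAlgHom φ f = perp F f := by
  rw [perp, ← hφ]
  rfl

end Duality

end SymmFn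

end

/-! ### The three equivalent conditions -/

theorem mainTheorem7 {K : Type*} [CommRing K] (F : SymmFn.SymSeries K) :
    [SymmFn.IsGroupLike F,
      ∃ φ : SymmFn.SymFun K →ₐ[K] K, φ.toLinearMap = SymmFn.hall F,
      ∃ φ : SymmFn.SymFun K ≃ₐ[K] SymmFn.SymFun K, φ.toLinearMap = SymmFn.perp F].TFAE := by
  tfae_have 1 → 2 := fun ⟨h1, h2⟩ =>
    ⟨AlgHom.ofLinearMap (SymmFn.hall F) (by rw [SymmFn.hall_one, h2])
      ((SymmFn.inXY_eq_mul_iff F).1 h1), rfl⟩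
  tfae_have 2 → 1 := by
    rintro ⟨φ, hφ⟩
    have h : ∀ f, SymmFn.hall F f = φ f := fun f => (LinearMap.congr_fun hφ f).symm
    refine ⟨(SymmFn.inXY_eq_mul_iff F).2 fun f g => ?_, ?_⟩
    · rw [h, h, h, map_mul]
    · rw [← SymmFn.hall_one, h, map_one]
  tfae_have 2 → 3 := by
    rintro ⟨φ, hφ⟩
    have hF : MvPowerSeries.constantCoeff F.1 = 1 := by
      rw [← SymmFn.hall_one, ← hφ]
      exact map_one φ
    have hb : Function.Bijective (SymmFn.perpAlgHom φ) := by
      rw [show ⇑(SymmFn.perpAlgHom φ) = SymmFn.perp F from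
        funext (SymmFn.perpAlgHom_apply hφ)]
      exact SymmFn.perp_bijective hF
    exact ⟨AlgEquiv.ofBijective _ hb, LinearMap.ext (SymmFn.perpAlgHom_apply hφ)⟩
  tfae_have 3 → 2 := by
    rintro ⟨φ, hφ⟩
    -- The functional (F, -) is `φ` followed by the constant term, a composite of ring
    -- homomorphisms.
    have h : ∀ f, SymmFn.hall F f = MvPowerSeries.constantCoeff (φ f).1 := fun f => by
      rw [← SymmFn.constantCoeff_perp, ← hφ]
      rfl
    refine ⟨AlgHom.ofLinearMap (SymmFn.hall F) ?_ fun f g => ?_, rfl⟩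
    · rw [h, map_one, OneMemClass.coe_one, map_one]
    · rw [h, h, h, map_mul, MulMemClass.coe_mul, map_mul]
  tfae_finish
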